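/- **Process.** There are $n$ nodes, and initially exactly one node is informed. In each round of the *single incoming call pull protocol*, every uninformed node calls a node chosen uniformly at random among all $n$ nodes (itself included), independently of the others. Every node that is called accepts exactly one of its incoming calls, chosen uniformly at random and independently of the other nodes, and drops the rest. An uninformed node becomes informed if its call is accepted by a node that was informed at the start of the round; informed nodes stay informed. Let $T$ be the first time (number of rounds) at which all $n$ nodes are informed. **Theorem.** There is a constant $C$ such that for all $n \ge 2$ and every choice of the initially informed node, $\mathbb{E}[T]$ is finite and $$\bigl|\,\mathbb{E}[T] - \bigl(\log_{2-1/e} n + \log_2 \ln n\bigr)\bigr| \le C .$$ Moreover, the protocol is homogeneous: in a round starting with $k \ge 1$ informed nodes, every uninformed node becomes informed with the same probability $p_k = p_k(n)$, whichever $k$ nodes are informed. Let $c_k = c_k(n)$ be the smallest number such that $\operatorname{Cov}[X_1,X_2] \le c_k$ for the indicator variables $X_1, X_2$ of the events that two distinct uninformed nodes become informed in a round starting with $k$ informed nodes (and $c_k = 0$ if there is only one uninformed node). With $\gamma_n = 1-\frac1e$ and $\ell = 2$, the protocol satisfies the following four conditions, each for its own constants $a, b, c, f, g$. 1. *Upper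 exponential growth:* there are $a,b,c \ge 0$ and $0<f<1$ with $af<1$ such that for all large enough $n$ and all integers $1 \le k < fn$, $$p_k \ge \gamma_n \tfrac kn\left(1 - a\tfrac kn - \tfrac b{\ln n}\right) \quad\text{and}\quad c_k \le c\,\tfrac{k}{n^2}.$$ 2. *Lower exponential growth:* there are $a,b,c \ge 0$ and $0<f<1$ such that for all large enough $n$ and all integers $1 \le k < fn$, $$p_k \le \gamma_n \tfrac kn\left(1 + a\tfrac kn + \tfrac b{\ln n}\right) \quad\text{and}\quad c_k \le c\,\tfrac{k}{n^2}.$$ 3. *Upper double exponential shrinking:* there are $a,c \ge 0$ and $0<g\le 1$ with $a g^{\ell-1} < 1$ such that for all large enough $n$ and all integers $1 \le u \le gn$ with $u<n$, $$1 - p_{n-u} \le a\left(\tfrac un\right)^{\ell-1} \quad\text{and}\quad c_{n-u} \le c\,\tfrac{n}{u^2}.$$ 4. *Lower double exponential shrinking:* there are $a>0$, $c \ge 0$ and $0<g\le 1$ with $a g^{\ell-1} < 1$ such that for all large enough $n$ and all integers $1 \le u \le gn$ with $u<n$, $$1 - p_{n-u} \ge a\left(\tfrac un\right)^{\ell-1}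 \quad\text{and}\quad c_{n-u} \le c\,\tfrac{n}{u^2}.$$ -/

import Mathlib

open MeasureTheory ProbabilityTheory
open scoped ENNReal

noncomputable section

namespace RumorSpreading

/-! ### Memoryless rumor spreading processes on `n` nodes -/

/-- The sets of nodes form a finite discrete measurable space. -/
instance instMeasurableSpaceNodeSet (n : ℕ) : MeasurableSpace (Finset (Fin n)) := ⊤

instance instDiscreteMeasurableSpaceNodeSet (n : ℕ) :
    DiscreteMeasurableSpace (Finset (Fin n)) := ⟨fun _ => trivial⟩

/-- The law of one round of a memoryless process on the nodes `Fin n`: for each set of nodes that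
are informed at the beginning of the round, the law of the set of nodes that are informed at the
end of the round. -/
abbrev RoundLaw (n : ℕ) : Type := Finset (Fin n) → PMF (Finset (Fin n))

/-- Probability that node `x` is informed at the end of a round that starts with exactly the
nodes in `S` informed. -/
def informProb {n : ℕ} (R : RoundLaw n) (S : Finset (Fin n)) (x : Fin n) : ℝ :=
  (R S).toMeasure.real {S' | x ∈ S'}

/-- Indicator random variable of the event that `x` is informed at the end of the round. -/
def informedIndicator {n : ℕ} (x : Fin n) : Finset (Fin n) → ℝ :=
  fun S' => if x ∈ S' then 1 else 0

/-- The process is homogeneous with success probabilities `p`: informed nodes stay informed, and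
in a round starting with `k ≥ 1` informed nodes each uninformed node becomes informed with
probability `p k`, whichever nodes are informed. -/
def IsHomogeneous {n : ℕ} (R : RoundLaw n) (p : ℕ → ℝ) : Prop :=
  (∀ S, ∀ S' ∈ (R S).support, S ⊆ S') ∧
    ∀ S : Finset (Fin n), S.Nonempty → ∀ x ∉ S, informProb R S x = p S.card

/-- The covariance number `c_k`: the smallest upper bound for the covariance of the indicators of
the events that `x₁`, `x₂` become informed, over all rounds starting with `k` informed nodes and
all pairs of distinct uninformed nodes. (If there is no such pair, i.e. `k ≥ n - 1`, the value
is `0`.) -/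
def covNumber {n : ℕ} (R : RoundLaw n) (k : ℕ) : ℝ :=
  sInf {c : ℝ | ∀ S : Finset (Fin n), S.card = k → ∀ x₁ ∉ S, ∀ x₂ ∉ S, x₁ ≠ x₂ →
    cov[informedIndicator x₁, informedIndicator x₂; (R S).toMeasure] ≤ c}

/-! ### The rumor spreading time -/

/-- Transition kernel of round `t + 1`, as a function of the history of the first `t` rounds. It
depends on the current set of informed nodes only. -/
def roundKernel {n : ℕ} (R : RoundLaw n) (t : ℕ) :
    Kernel ((_i : Finset.Iic t) → Finset (Fin n)) (Finset (Fin n)) :=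
  Kernel.ofFunOfCountable fun h => (R (h ⟨t, Finset.mem_Iic.2 le_rfl⟩)).toMeasure

instance {n : ℕ} (R : RoundLaw n) (t : ℕ) : IsMarkovKernel (roundKernel R t) :=
  ⟨fun h => inferInstanceAs
    (IsProbabilityMeasure (R (h ⟨t, Finset.mem_Iic.2 le_rfl⟩)).toMeasure)⟩

/-- Law of the whole process, i.e. of the sequence `(ω t)` of the sets of nodes informed at the
end of round `t`, when initially exactly the node `v` is informed. -/
def processLaw {n : ℕ} (R : RoundLaw n) (v : Fin n) : Measure (ℕ → Finset (Fin n)) :=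
  Kernel.traj (X := fun _ => Finset (Fin n)) (roundKernel R) 0 (fun _ => {v})

/-- The first time at which all `n` nodes are informed (`∞` if this never happens). -/
def spreadingTime {n : ℕ} (ω : ℕ → Finset (Fin n)) : ℝ≥0∞ :=
  ⨅ (t : ℕ) (_ : n ≤ (ω t).card), (t : ℝ≥0∞)

/-- The expected rumor spreading time of the process started with the single informed
node `v`. -/
def expectedSpreadingTime {n : ℕ} (R : RoundLaw n) (v : Fin n) : ℝ≥0∞ :=
  ∫⁻ ω, spreadingTime ω ∂(processLaw R v)

/-! ### Growth and shrinking conditions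

Here `R` is a family of processes, one for each number `n` of nodes, with success
probabilities `p n k`. -/

/-- `γ n` is bounded between two positive constants. -/
def PosBounded (γ : ℕ → ℝ) : Prop :=
  ∃ lo hi : ℝ, 0 < lo ∧ ∀ n, lo ≤ γ n ∧ γ n ≤ hi

/-- Upper exponential growth conditions. -/
def UpperExpGrowth (R : (n : ℕ) → RoundLaw n) (p : ℕ → ℕ → ℝ) (γ : ℕ → ℝ) : Prop :=
  PosBounded γ ∧ ∃ a b c f : ℝ, 0 ≤ a ∧ 0 ≤ b ∧ 0 ≤ c ∧ 0 < f ∧ f < 1 ∧ a * f < 1 ∧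
    ∃ N : ℕ, ∀ n ≥ N, ∀ k : ℕ, 1 ≤ k → (k : ℝ) < f * n →
      γ n * ((k : ℝ) / n) * (1 - a * ((k : ℝ) / n) - b / Real.log n) ≤ p n k ∧
      covNumber (R n) k ≤ c * (k / (n : ℝ) ^ 2)

/-- Lower exponential growth conditions. -/
def LowerExpGrowth (R : (n : ℕ) → RoundLaw n) (p : ℕ → ℕ → ℝ) (γ : ℕ → ℝ) : Prop :=
  PosBounded γ ∧ ∃ a b c f : ℝ, 0 ≤ a ∧ 0 ≤ b ∧ 0 ≤ c ∧ 0 < f ∧ f < 1 ∧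
    ∃ N : ℕ, ∀ n ≥ N, ∀ k : ℕ, 1 ≤ k → (k : ℝ) < f * n →
      p n k ≤ γ n * ((k : ℝ) / n) * (1 + a * ((k : ℝ) / n) + b / Real.log n) ∧
      covNumber (R n) k ≤ c * (k / (n : ℝ) ^ 2)

/-- Upper double exponential shrinking conditions; `u` is the number of uninformed nodes. -/
def UpperDoubleExpShrinking (R : (n : ℕ) → RoundLaw n) (p : ℕ → ℕ → ℝ) (ℓ : ℝ) : Prop :=
  1 < ℓ ∧ ∃ a c g : ℝ, 0 ≤ a ∧ 0 ≤ c ∧ 0 < g ∧ g ≤ 1 ∧ a * g ^ (ℓ - 1) < 1 ∧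
    ∃ N : ℕ, ∀ n ≥ N, ∀ u : ℕ, 1 ≤ u → u < n → (u : ℝ) ≤ g * n →
      1 - p n (n - u) ≤ a * ((u : ℝ) / n) ^ (ℓ - 1) ∧
      covNumber (R n) (n - u) ≤ c * (n / (u : ℝ) ^ 2)

/-- Lower double exponential shrinking conditions. The constant `a` has to be positive, as the
bound on the probabilities is void otherwise. -/
def LowerDoubleExpShrinking (R : (n : ℕ) → RoundLaw n) (p : ℕ → ℕ → ℝ) (ℓ : ℝ) : Prop :=
  1 < ℓ ∧ ∃ a c g : ℝ, 0 < a ∧ 0 ≤ c ∧ 0 < g ∧ g ≤ 1 ∧ a * g ^ (ℓ - 1) < 1 ∧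
    ∃ N : ℕ, ∀ n ≥ N, ∀ u : ℕ, 1 ≤ u → u < n → (u : ℝ) ≤ g * n →
      a * ((u : ℝ) / n) ^ (ℓ - 1) ≤ 1 - p n (n - u) ∧
      covNumber (R n) (n - u) ≤ c * (n / (u : ℝ) ^ 2)

/-! ### The single incoming call pull protocol -/

/-- The incoming calls of node `y`: the uninformed nodes whose call goes to `y`. Here `call x` is
the node which `x` calls; informed nodes do not call, their value of `call` is ignored. -/
def callers {n : ℕ} (S : Finset (Fin n)) (call : Fin n → Fin n) (y : Fin n) : Finset (Fin n) :=
  {x | x ∉ S ∧ call x = y}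

/-- The possible answers of node `y`: one of its callers, or `none` if nobody calls `y`. -/
def answers {n : ℕ} (S : Finset (Fin n)) (call : Fin n → Fin n) (y : Fin n) :
    Finset (Option (Fin n)) :=
  if (callers S call y).Nonempty then (callers S call y).image some else {none}

theorem answers_nonempty {n : ℕ} (S : Finset (Fin n)) (call : Fin n → Fin n) (y : Fin n) :
    (answers S call y).Nonempty := by
  unfold answers
  split_ifs with h
  · exact h.image _
  · exact Finset.singleton_nonempty _

instance instNonemptyCall (n : ℕ) : Nonempty (Fin n → Fin n) := ⟨id⟩

/-- Each node that is called accepts exactly one of its incoming calls, chosen uniformly at random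
and independently of the other nodes (this is the uniform law on the product of the sets of
possible answers). -/
def acceptLaw {n : ℕ} (S : Finset (Fin n)) (call : Fin n → Fin n) :
    PMF (Fin n → Option (Fin n)) :=
  PMF.uniformOfFinset (Fintype.piFinset (answers S call))
    (Fintype.piFinset_nonempty.2 (answers_nonempty S call))

/-- The informed nodes at the end of the round: those informed before, and those whose call went
to an informed node and was accepted. -/
def updateInformed {n : ℕ} (S : Finset (Fin n)) (call : Fin n → Fin n)
    (acc : Fin n → Option (Fin n)) : Finset (Fin n) :=
  S ∪ Finset.univ.filter fun x => x ∉ S ∧ call x ∈ S ∧ acc (call x) = some x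

/-- One round of the single incoming call pull protocol: the uninformed nodes call nodes chosen
independently and uniformly at random among all nodes, themselves included, every called node
accepts one incoming call chosen uniformly at random, and an uninformed node becomes informed if
its call is accepted by an informed node. -/
def singlePull (n : ℕ) : RoundLaw n := fun S =>
  (PMF.uniformOfFintype (Fin n → Fin n)).bind fun call =>
    (acceptLaw S call).map (updateInformed S call)

end RumorSpreading

end

/-! A called informed node accepts exactly one call, so the number of newly informed nodes in a
round is the number `N` of informed nodes that are called. It depends on the calls alone, and the
number of informed nodes evolves as a Markov chain with occupancy increments. Write `k` for the
number of informed nodes, `u = n - k`, and `m = 1 - (1 - 1/n)^u` for the probability that a given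
node is called. Then `N` has mean `k m`, and because the events "not called" are negatively
correlated, its variance is at most `k m (1 - m)` (`integral_card_le_of_quadratic`).

Relabelling uninformed nodes preserves the law of a round. Averaging over them gives `p_k = k m /
u`, and averaging over pairs bounds the covariances. The four conditions are then estimates of `m`,
which is close to `1 - 1/e` for small `k` and to `u/n` for small `u`.

The expected time comes from additive drift, with no separate analysis of phases: a nonnegative
potential of `k` whose expected drop is at least 1 in every unfinished round bounds `E[T]` above by
its initial value, and one that vanishes at the end and drops by at most `1 + η` bounds `(1 + η)
E[T]` below. Both potentials are essentially `log_b (n/k)`, with `b = 2 - 1/e`, plus `log₂ (ln n /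
ln (n/u))`: growth multiplies `k` by about `b`, and shrinking roughly squares `u/n`, doubling `ln
(n/u)`.

The upper potential has correction terms that pay for the variance, for the deviation of `m` from `1
- 1/e`, for the middle range and for the constants lost in squaring. The lower potential is cut off
when `u` is of order `n^(3/4)`; above that, Chebyshev's inequality makes excessive drops so rare
that `η` times the initial potential stays bounded. -/

namespace RumorSpreading

/-! ### The process law, the spreading time and additive drift -/

section Trajectory

variable {n : ℕ} (R : RoundLaw n) (v : Fin n)

instance instIsProbabilityMeasureProcessLaw : IsProbabilityMeasure (processLaw R v) := by
  unfold processLaw; infer_instance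

/-- The Markov property: the history up to `t + 1` is the history up to `t` composed with
`roundKernel`, which reads only the last coordinate. All later facts about trajectories are reduced
to single rounds through this identity. -/
theorem lintegral_processLaw_succ (t : ℕ)
    (F : Finset (Fin n) → Finset (Fin n) → ℝ≥0∞) :
    ∫⁻ ω, F (ω t) (ω (t + 1)) ∂processLaw R v =
      ∫⁻ ω, ∫⁻ S', F (ω t) S' ∂(R (ω t)).toMeasure ∂processLaw R v := by
  have h := Kernel.partialTraj_compProd_eq_map_traj (X := fun _ => Finset (Fin n))
    (κ := roundKernel R) (zero_le (a := t))
    (x₀ := fun _ => {v})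
  let G : ((_i : Finset.Iic t) → Finset (Fin n)) × Finset (Fin n) → ℝ≥0∞ :=
    fun z => F (z.1 ⟨t, Finset.mem_Iic.2 le_rfl⟩) z.2
  have hG : Measurable G := .of_discrete
  have h1 : ∫⁻ ω, F (ω t) (ω (t + 1)) ∂processLaw R v = ∫⁻ z, G z ∂
      ((processLaw R v).map fun x => (Preorder.frestrictLe t x, x (t + 1))) := by
    rw [lintegral_map hG (by fun_prop)]
    rfl
  rw [h1, processLaw, ← h, Measure.lintegral_compProd hG, ← Kernel.traj_map_frestrictLe,
    Kernel.map_apply _ (by fun_prop), lintegral_map]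
  · rfl
  · exact hG.lintegral_kernel_prod_right'
  · fun_prop

theorem ae_processLaw_zero : ∀ᵐ ω ∂processLaw R v, ω 0 = {v} := by
  have h := Kernel.traj_map_frestrictLe_apply (X := fun _ => Finset (Fin n))
    (κ := roundKernel R) 0 0 (fun _ => {v})
  rw [Kernel.partialTraj_self, Kernel.id_apply] at h
  have h2 : ∀ᵐ z ∂(processLaw R v).map (Preorder.frestrictLe 0),
      z ⟨0, Finset.mem_Iic.2 le_rfl⟩ = {v} := by
    rw [processLaw, h, ae_dirac_eq]
    rfl
  exact ae_of_ae_map (by fun_prop) h2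

theorem ae_subset {R : RoundLaw n} (hR : ∀ S, ∀ S' ∈ (R S).support, S ⊆ S')
    (S : Finset (Fin n)) : ∀ᵐ S' ∂(R S).toMeasure, S ⊆ S' := by
  have hs : ∀ᵐ S' ∂(R S).toMeasure, S' ∈ (R S).support := by
    rw [ae_iff, PMF.toMeasure_apply_eq_zero_iff _ .of_discrete]
    exact Set.disjoint_left.2 fun x h1 h2 => h2 h1
  filter_upwards [hs] with S' hS' using hR S S' hS'

theorem ae_processLaw_monotone (hR : ∀ S, ∀ S' ∈ (R S).support, S ⊆ S') :
    ∀ᵐ ω ∂processLaw R v, Monotone ω := by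
  have : ∀ᵐ ω ∂processLaw R v, ∀ t, ω t ⊆ ω (t + 1) := by
    rw [ae_all_iff]
    intro t
    have h := lintegral_processLaw_succ R v t fun S S' => if S ⊆ S' then 0 else 1
    have hz : ∀ S, ∫⁻ S', (if S ⊆ S' then 0 else 1) ∂(R S).toMeasure = 0 := by
      intro S
      rw [lintegral_eq_zero_iff .of_discrete]
      filter_upwards [ae_subset hR S] with S' hS'
      rw [if_pos hS']
      rfl
    simp_rw [hz, lintegral_zero] at h
    rw [lintegral_eq_zero_iff] at h
    · filter_upwards [h] with ω hω
      by_contra hc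
      simp [hc] at hω
    · have h1 : Measurable fun z : Finset (Fin n) × Finset (Fin n) =>
          if z.1 ⊆ z.2 then (0 : ℝ≥0∞) else 1 := .of_discrete
      have h2 : Measurable fun ω : ℕ → Finset (Fin n) => (ω t, ω (t + 1)) := by fun_prop
      exact h1.comp h2
  filter_upwards [this] with ω hω using monotone_nat_of_le_succ hω

theorem spreadingTime_le_tsum (ω : ℕ → Finset (Fin n)) :
    spreadingTime ω ≤ ∑' t, if (ω t).card < n then 1 else 0 := by
  by_cases h : ∃ t, n ≤ (ω t).card
  · classical
    refine (iInf₂_le (Nat.find h) (Nat.find_spec h)).trans ?_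
    refine le_trans (le_of_eq ?_) (ENNReal.sum_le_tsum (Finset.range (Nat.find h)))
    rw [Finset.sum_congr rfl (g := fun _ => 1)]
    · simp
    · intro t ht
      rw [if_pos (not_le.1 (Nat.find_min h (Finset.mem_range.1 ht)))]
  · push Not at h
    simp [h]

/-- Together with the previous bound, this writes the spreading time as the number of unfinished
rounds. Only this direction needs monotonicity: a finished trajectory must stay finished. -/
theorem tsum_le_spreadingTime {ω : ℕ → Finset (Fin n)} (hω : Monotone ω) :
    ∑' t, (if (ω t).card < n then 1 else 0) ≤ spreadingTime ω := by
  refine le_iInf₂ fun t ht => ?_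
  rw [tsum_eq_sum (s := Finset.range t)]
  · refine (Finset.sum_le_card_nsmul _ _ 1 fun s _ => by split_ifs <;> simp).trans ?_
    simp
  · intro s hs
    rw [if_neg]
    have := Finset.card_le_card (hω (not_lt.1 (fun h => hs (Finset.mem_range.2 h))))
    omega

/-- The probability that not all nodes are informed after `t` rounds. -/
noncomputable def unfinishedProb (t : ℕ) : ℝ≥0∞ :=
  ∫⁻ ω, (if (ω t).card < n then 1 else 0) ∂processLaw R v

theorem measurable_processLaw_eval (f : Finset (Fin n) → ℝ≥0∞) (t : ℕ) :
    Measurable fun ω : ℕ → Finset (Fin n) => f (ω t) :=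
  (measurable_from_top (f := f)).comp (measurable_pi_apply t)

theorem expectedSpreadingTime_eq_tsum (hR : ∀ S, ∀ S' ∈ (R S).support, S ⊆ S') :
    expectedSpreadingTime R v = ∑' t, unfinishedProb R v t := by
  unfold expectedSpreadingTime unfinishedProb
  rw [← lintegral_tsum fun t => (measurable_processLaw_eval
    (fun S => if S.card < n then 1 else 0) t).aemeasurable]
  refine lintegral_congr_ae ?_
  filter_upwards [ae_processLaw_monotone R v hR] with ω hω
  exact le_antisymm (spreadingTime_le_tsum ω) (tsum_le_spreadingTime hω)

variable {R}

/-- Additive drift theorem, upper bound. -/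
theorem expectedSpreadingTime_le_of_drift (hR : ∀ S, ∀ S' ∈ (R S).support, S ⊆ S')
    (h : Finset (Fin n) → ℝ≥0∞)
    (hd : ∀ S, (if S.card < n then 1 else 0) + ∫⁻ S', h S' ∂(R S).toMeasure ≤ h S) :
    expectedSpreadingTime R v ≤ h {v} := by
  rw [expectedSpreadingTime_eq_tsum R v hR, ENNReal.tsum_eq_iSup_nat]
  refine iSup_le fun N => ?_
  -- Telescoping the drift: elapsed unfinished time plus the remaining potential never increases in
  -- expectation.
  have key : ∀ N, ∑ t ∈ Finset.range N, unfinishedProb R v t +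
      ∫⁻ ω, h (ω N) ∂processLaw R v ≤ h {v} := by
    intro N
    induction N with
    | zero =>
      rw [lintegral_congr_ae (g := fun _ => h {v})]
      · simp
      · filter_upwards [ae_processLaw_zero R v] with ω hω using by rw [hω]
    | succ N ih =>
      refine le_trans ?_ ih
      rw [Finset.sum_range_succ, add_assoc]
      gcongr
      rw [lintegral_processLaw_succ R v N fun _ S' => h S', unfinishedProb,
        ← lintegral_add_left (measurable_processLaw_eval
          (fun S => if S.card < n then 1 else 0) N)]
      exact lintegral_mono fun ω => hd (ω N)
  exact le_self_add.trans (key N)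

/-- Additive drift theorem, lower bound. -/
theorem le_expectedSpreadingTime_of_drift (hR : ∀ S, ∀ S' ∈ (R S).support, S ⊆ S')
    (hfin : expectedSpreadingTime R v ≠ ∞) (h : Finset (Fin n) → ℝ≥0∞) {M c : ℝ≥0∞}
    (hM : M ≠ ∞) (hhM : ∀ S, h S ≤ M * (if S.card < n then 1 else 0))
    (hd : ∀ S, h S ≤ c * (if S.card < n then 1 else 0) + ∫⁻ S', h S' ∂(R S).toMeasure) :
    h {v} ≤ c * expectedSpreadingTime R v := by
  rw [expectedSpreadingTime_eq_tsum R v hR] at hfin ⊢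
  have key : ∀ N, h {v} ≤ c * ∑ t ∈ Finset.range N, unfinishedProb R v t +
      ∫⁻ ω, h (ω N) ∂processLaw R v := by
    intro N
    induction N with
    | zero =>
      rw [lintegral_congr_ae (g := fun _ => h {v})]
      · simp
      · filter_upwards [ae_processLaw_zero R v] with ω hω using by rw [hω]
    | succ N ih =>
      refine ih.trans ?_
      rw [Finset.sum_range_succ, mul_add, add_assoc]
      gcongr
      have hm := measurable_processLaw_eval (n := n) (fun S => if S.card < n then 1 else 0) N
      rw [lintegral_processLaw_succ R v N fun _ S' => h S', unfinishedProb,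
        ← lintegral_const_mul _ hm, ← lintegral_add_left (hm.const_mul _)]
      exact lintegral_mono fun ω => hd (ω N)
  -- The remaining potential is at most `M` times the probability of being unfinished. These
  -- probabilities have the finite sum `E[T]`, so they tend to zero.
  have hlim : Filter.Tendsto (fun N => c * ∑' t, unfinishedProb R v t +
      M * unfinishedProb R v N) Filter.atTop (nhds (c * ∑' t, unfinishedProb R v t + M * 0)) :=
    tendsto_const_nhds.add (ENNReal.Tendsto.const_mul
      (ENNReal.tendsto_atTop_zero_of_tsum_ne_top hfin) (Or.inr hM))
  rw [mul_zero, add_zero] at hlim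
  refine ge_of_tendsto' hlim fun N => (key N).trans ?_
  gcongr
  · exact ENNReal.sum_le_tsum _
  · rw [unfinishedProb, ← lintegral_const_mul _
      (measurable_processLaw_eval (fun S => if S.card < n then 1 else 0) N)]
    exact lintegral_mono fun ω => hhM (ω N)

end Trajectory

/-! ### Integrals against finite mixtures and images -/

section Pmf

theorem integral_bind_eq_sum {α β : Type*} [Fintype α] [Fintype β] [MeasurableSpace β]
    [MeasurableSingletonClass β] (p : PMF α) (g : α → PMF β) (f : β → ℝ) :
    ∫ b, f b ∂(p.bind g).toMeasure = ∑ a, (p a).toReal * ∫ b, f b ∂(g a).toMeasure := by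
  simp_rw [PMF.integral_eq_sum, PMF.bind_apply, tsum_fintype, smul_eq_mul, Finset.mul_sum]
  rw [Finset.sum_comm]
  refine Finset.sum_congr rfl fun b _ => ?_
  rw [ENNReal.toReal_sum fun a _ => ENNReal.mul_ne_top (PMF.apply_ne_top _ _)
    (PMF.apply_ne_top _ _), Finset.sum_mul]
  simp_rw [ENNReal.toReal_mul, mul_assoc]

theorem integral_map_eq_sum {α β : Type*} [Fintype α] [Fintype β] [MeasurableSpace β]
    [MeasurableSingletonClass β] (p : PMF α) (g : α → β) (f : β → ℝ) :
    ∫ b, f b ∂(p.map g).toMeasure = ∑ a, (p a).toReal * f (g a) := by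
  rw [← PMF.bind_pure_comp, integral_bind_eq_sum]
  simp [PMF.toMeasure_pure, integral_dirac]

end Pmf

/-! ### One round: counting and symmetry -/

section Round

variable {n : ℕ} (S : Finset (Fin n))

theorem integral_singlePull (f : Finset (Fin n) → ℝ) :
    ∫ S', f S' ∂(singlePull n S).toMeasure = ∑ call : Fin n → Fin n, ((n : ℝ) ^ n)⁻¹ *
      ∑ acc ∈ Fintype.piFinset (answers S call),
        ((Fintype.piFinset (answers S call)).card : ℝ)⁻¹ * f (updateInformed S call acc) := by
  rw [singlePull, integral_bind_eq_sum]
  refine Finset.sum_congr rfl fun call _ => ?_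
  rw [integral_map_eq_sum]
  congr 1
  · simp [PMF.uniformOfFintype_apply]
  · rw [← Finset.sum_subset (Finset.subset_univ (Fintype.piFinset (answers S call)))]
    · refine Finset.sum_congr rfl fun acc hacc => ?_
      rw [acceptLaw, PMF.uniformOfFinset_apply_of_mem _ hacc]
      simp
    · intro acc _ hacc
      rw [acceptLaw, PMF.uniformOfFinset_apply_of_notMem _ hacc]
      simp

theorem mem_callers {call : Fin n → Fin n} {x y : Fin n} :
    x ∈ callers S call y ↔ x ∉ S ∧ call x = y := by
  simp [callers]

theorem some_mem_answers {call : Fin n → Fin n} {x y : Fin n} :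
    some x ∈ answers S call y ↔ x ∉ S ∧ call x = y := by
  unfold answers
  split_ifs with h
  · simp [mem_callers]
  · have h' : ¬(x ∉ S ∧ call x = y) := fun hz => h ⟨x, (mem_callers S).2 hz⟩
    simp only [Finset.mem_singleton, reduceCtorEq, h']

theorem none_mem_answers {call : Fin n → Fin n} {y : Fin n} :
    none ∈ answers S call y ↔ ∀ x, x ∉ S → call x ≠ y := by
  unfold answers
  split_ifs with h
  · obtain ⟨x, hx⟩ := h
    rw [mem_callers] at hx
    simp only [Finset.mem_image, reduceCtorEq, and_false, exists_false, false_iff]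
    exact fun h => h x hx.1 hx.2
  · simpa [mem_callers, Finset.not_nonempty_iff_eq_empty, Finset.eq_empty_iff_forall_notMem]
      using h

theorem mem_updateInformed {call : Fin n → Fin n} {acc : Fin n → Option (Fin n)} {x : Fin n} :
    x ∈ updateInformed S call acc ↔ x ∈ S ∨ x ∉ S ∧ call x ∈ S ∧ acc (call x) = some x := by
  simp [updateInformed]

theorem subset_updateInformed (call : Fin n → Fin n) (acc : Fin n → Option (Fin n)) :
    S ⊆ updateInformed S call acc := Finset.subset_union_left

theorem subset_of_mem_support {S' : Finset (Fin n)} (h : S' ∈ (singlePull n S).support) :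
    S ⊆ S' := by
  rw [singlePull, PMF.mem_support_bind_iff] at h
  obtain ⟨call, _, h⟩ := h
  rw [PMF.mem_support_map_iff] at h
  obtain ⟨acc, _, rfl⟩ := h
  exact subset_updateInformed S call acc

/-- The number of informed nodes that are called. -/
def calledCount (call : Fin n → Fin n) : ℕ := {y ∈ S | (callers S call y).Nonempty}.card

/-- Sending a newly informed node to the node it called is a bijection onto the called informed
nodes, since each of these accepts exactly one caller. Hence the random acceptances do not affect
the count. -/
theorem card_updateInformed {call : Fin n → Fin n} {acc : Fin n → Option (Fin n)}
    (hacc : acc ∈ Fintype.piFinset (answers S call)) :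
    (updateInformed S call acc).card = S.card + calledCount S call := by
  rw [Fintype.mem_piFinset] at hacc
  rw [updateInformed, Finset.card_union_of_disjoint, calledCount]
  · congr 1
    refine Finset.card_bij (fun x _ => call x) ?_ ?_ ?_
    · intro x hx
      simp only [Finset.mem_filter, Finset.mem_univ, true_and] at hx ⊢
      exact ⟨hx.2.1, x, (mem_callers S).2 ⟨hx.1, rfl⟩⟩
    · intro x hx x' hx' h
      simp only [Finset.mem_filter, Finset.mem_univ, true_and] at hx hx'
      have := hx.2.2
      rw [h, hx'.2.2] at this
      exact (Option.some_injective _ this).symm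
    · intro y hy
      simp only [Finset.mem_filter] at hy
      obtain ⟨hyS, x, hx⟩ := hy
      rw [mem_callers] at hx
      rcases h : acc y with _ | z
      · have := hacc y
        rw [h, none_mem_answers] at this
        exact absurd hx.2 (this x hx.1)
      · have := hacc y
        rw [h, some_mem_answers] at this
        refine ⟨z, ?_, this.2⟩
        simp [this.1, this.2, hyS, h]
  · rw [Finset.disjoint_left]
    intro x hx hx'
    simp [hx] at hx'

theorem integral_card_singlePull (f : ℕ → ℝ) :
    ∫ S', f S'.card ∂(singlePull n S).toMeasure =
      ∑ call : Fin n → Fin n, ((n : ℝ) ^ n)⁻¹ * f (S.card + calledCount S call) := by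
  rw [integral_singlePull]
  refine Finset.sum_congr rfl fun call _ => ?_
  congr 1
  rw [Finset.sum_congr rfl fun acc hacc => by rw [card_updateInformed S hacc],
    Finset.sum_const, nsmul_eq_mul, ← mul_assoc, mul_inv_cancel₀, one_mul]
  exact Nat.cast_ne_zero.2
    (Finset.card_ne_zero.2 (Fintype.piFinset_nonempty.2 (answers_nonempty S call)))

/-- Relabelling of the uninformed nodes does not change the law of a round. -/
theorem integral_singlePull_map (σ : Equiv.Perm (Fin n)) (hσ : ∀ x, σ x ∈ S ↔ x ∈ S)
    (f : Finset (Fin n) → ℝ) :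
    ∫ S', f (S'.map σ.toEmbedding) ∂(singlePull n S).toMeasure =
      ∫ S', f S' ∂(singlePull n S).toMeasure := by
  rw [integral_singlePull, integral_singlePull]
  -- Only the callers are relabelled; the nodes they call stay fixed. The answers are relabelled
  -- accordingly by `e` below.
  refine Fintype.sum_equiv (Equiv.arrowCongr σ (Equiv.refl _)) _ _ fun call => ?_
  have hcall : ∀ x, (Equiv.arrowCongr σ (Equiv.refl _)) call (σ x) = call x := by simp
  generalize (Equiv.arrowCongr σ (Equiv.refl _)) call = call' at hcall
  obtain ⟨e, he⟩ : ∃ e : (Fin n → Option (Fin n)) ≃ (Fin n → Option (Fin n)),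
      ∀ acc y, e acc y = (acc y).map σ :=
    ⟨Equiv.arrowCongr (Equiv.refl _) (Equiv.optionCongr σ), by simp⟩
  have hmem : ∀ acc, acc ∈ Fintype.piFinset (answers S call) ↔
      e acc ∈ Fintype.piFinset (answers S call') := by
    intro acc
    rw [Fintype.mem_piFinset, Fintype.mem_piFinset]
    refine forall_congr' fun y => ?_
    rcases h : acc y with _ | x
    · rw [he, h, Option.map_none, none_mem_answers, none_mem_answers,
        ← σ.forall_congr_right (q := fun x => x ∉ S → call' x ≠ y)]
      simp only [hσ, hcall]
    · rw [he, h, Option.map_some, some_mem_answers, some_mem_answers, hσ, hcall]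
  refine congrArg _ ?_
  have hcard : (Fintype.piFinset (answers S call)).card =
      (Fintype.piFinset (answers S call')).card := Finset.card_equiv e hmem
  rw [hcard]
  refine Finset.sum_equiv e hmem fun acc hacc => ?_
  refine congrArg _ (congrArg f ?_)
  ext x
  obtain ⟨x, rfl⟩ := σ.surjective x
  rw [Finset.mem_map_equiv, Equiv.symm_apply_apply, mem_updateInformed, mem_updateInformed,
    hσ, hcall, he]
  simp [Option.map_eq_some_iff]

theorem inv_pow_mul_card_avoid (hn : 0 < n) (A : Finset (Fin n)) :
    ∑ call : Fin n → Fin n, ((n : ℝ) ^ n)⁻¹ * (if ∀ x, x ∉ S → call x ∉ A then 1 else 0) =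
      (1 - A.card / n) ^ (n - S.card) := by
  -- A product set: entries of informed nodes are unconstrained, as their calls are ignored, so only
  -- `n - S.card` factors carry a restriction.
  have h : (Finset.univ.filter fun call : Fin n → Fin n => ∀ x, x ∉ S → call x ∉ A) =
      Fintype.piFinset fun x => if x ∈ S then Finset.univ else Aᶜ := by
    ext call
    simp only [Finset.mem_filter, Finset.mem_univ, true_and, Fintype.mem_piFinset]
    refine forall_congr' fun x => ?_
    by_cases hx : x ∈ S <;> simp [hx]
  have hn' : (n : ℝ) ≠ 0 := by positivity
  have hS : S.card ≤ n := by simpa using S.card_le_univ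
  have hA : A.card ≤ n := by simpa using A.card_le_univ
  rw [← Finset.mul_sum, Finset.sum_boole, h, Fintype.card_piFinset]
  have : ∀ x, (if x ∈ S then (Finset.univ : Finset (Fin n)) else Aᶜ).card =
      if x ∈ S then n else n - A.card := by
    intro x
    split_ifs <;> simp [Finset.card_compl]
  simp_rw [this]
  rw [Finset.prod_ite, Finset.prod_const, Finset.prod_const, Finset.filter_mem_eq_inter,
    Finset.univ_inter, ← Finset.compl_filter, Finset.filter_mem_eq_inter, Finset.univ_inter,
    Finset.card_compl, Fintype.card_fin]
  push_cast [hA]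
  rw [show (1 - (A.card : ℝ) / n) = (n - A.card) / n by field_simp, div_pow]
  have : (n : ℝ) ^ n = n ^ S.card * n ^ (n - S.card) := by
    rw [← pow_add, Nat.add_sub_cancel' hS]
  rw [this]
  field_simp

end Round

/-! ### First and second moments of the number of newly informed nodes -/

section Moments

variable {n : ℕ} (S : Finset (Fin n))

theorem calledCount_le (call : Fin n → Fin n) : calledCount S call ≤ S.card :=
  Finset.card_filter_le _ _

theorem card_add_calledCount_le (call : Fin n → Fin n) : S.card + calledCount S call ≤ n := by
  obtain ⟨acc, hacc⟩ := Fintype.piFinset_nonempty.2 (answers_nonempty S call)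
  rw [← card_updateInformed S hacc]
  simpa using (updateInformed S call acc).card_le_univ

/-- The probability that a given node is not called in a round that starts with `k` informed
nodes. -/
noncomputable def missProb (n k : ℕ) : ℝ := (1 - 1 / (n : ℝ)) ^ (n - k)

/-- Indicator that no node of `A` is called. -/
noncomputable def avoidIndicator (A : Finset (Fin n)) (call : Fin n → Fin n) : ℝ :=
  if ∀ x, x ∉ S → call x ∉ A then 1 else 0

theorem avoidIndicator_mul (A B : Finset (Fin n)) (call : Fin n → Fin n) :
    avoidIndicator S A call * avoidIndicator S B call = avoidIndicator S (A ∪ B) call := by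
  unfold avoidIndicator
  rw [ite_zero_mul_ite_zero, one_mul]
  refine if_congr ?_ rfl rfl
  simp only [Finset.mem_union, not_or]
  exact ⟨fun h x hx => ⟨h.1 x hx, h.2 x hx⟩, fun h => ⟨fun x hx => (h x hx).1,
    fun x hx => (h x hx).2⟩⟩

theorem calledCount_eq_sum (call : Fin n → Fin n) :
    (calledCount S call : ℝ) = ∑ y ∈ S, (1 - avoidIndicator S {y} call) := by
  unfold calledCount avoidIndicator
  rw [Finset.card_filter]
  push_cast
  refine Finset.sum_congr rfl fun y _ => ?_
  by_cases h : (callers S call y).Nonempty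
  · obtain ⟨x, hx⟩ := h
    rw [if_pos ⟨x, hx⟩, if_neg]
    · simp
    · rw [mem_callers] at hx
      push Not
      exact ⟨x, hx.1, by simp [hx.2]⟩
  · rw [if_neg h, if_pos]
    · simp
    · intro x hx hxy
      exact h ⟨x, (mem_callers S).2 ⟨hx, by simpa using hxy⟩⟩

theorem calledCount_mul_sub (call : Fin n → Fin n) :
    (calledCount S call : ℝ) * calledCount S call - calledCount S call =
      ∑ z ∈ S.offDiag, (1 - avoidIndicator S {z.1} call - avoidIndicator S {z.2} call +
        avoidIndicator S {z.1, z.2} call) := by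
  have h : ∀ y, (1 - avoidIndicator S {y} call) * (1 - avoidIndicator S {y} call) =
      1 - avoidIndicator S {y} call := by
    intro y
    have := avoidIndicator_mul S {y} {y} call
    rw [Finset.union_idempotent] at this
    linear_combination this
  rw [calledCount_eq_sum, Finset.sum_mul_sum, ← Finset.sum_product', ← Finset.diag_union_offDiag,
    Finset.sum_union (Finset.disjoint_diag_offDiag _), Finset.sum_diag]
  simp_rw [h]
  rw [add_sub_cancel_left]
  refine Finset.sum_congr rfl fun z _ => ?_
  have := avoidIndicator_mul S {z.1} {z.2} call
  rw [Finset.singleton_union] at this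
  linear_combination this

theorem sum_inv_pow (hn : 0 < n) : ∑ _call : Fin n → Fin n, ((n : ℝ) ^ n)⁻¹ = 1 := by
  have : (n : ℝ) ≠ 0 := by positivity
  simp [this]

theorem sum_avoidIndicator (hn : 0 < n) (A : Finset (Fin n)) :
    ∑ call : Fin n → Fin n, ((n : ℝ) ^ n)⁻¹ * avoidIndicator S A call =
      (1 - A.card / n) ^ (n - S.card) := inv_pow_mul_card_avoid S hn A

theorem sum_calledCount (hn : 0 < n) :
    ∑ call : Fin n → Fin n, ((n : ℝ) ^ n)⁻¹ * calledCount S call =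
      S.card * (1 - missProb n S.card) := by
  simp_rw [calledCount_eq_sum, Finset.mul_sum]
  rw [Finset.sum_comm]
  simp_rw [mul_sub, mul_one, Finset.sum_sub_distrib, sum_inv_pow hn, sum_avoidIndicator S hn]
  simp [missProb]

theorem sum_calledCount_mul_sub (hn : 0 < n) :
    ∑ call : Fin n → Fin n, ((n : ℝ) ^ n)⁻¹ *
        ((calledCount S call : ℝ) * calledCount S call - calledCount S call) =
      (S.card * S.card - S.card) *
        (1 - 2 * missProb n S.card + (1 - 2 / (n : ℝ)) ^ (n - S.card)) := by
  simp_rw [calledCount_mul_sub, Finset.mul_sum]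
  rw [Finset.sum_comm]
  simp_rw [mul_add, mul_sub, mul_one, Finset.sum_add_distrib, Finset.sum_sub_distrib,
    sum_inv_pow hn, sum_avoidIndicator S hn]
  have h : ∑ z ∈ S.offDiag, (1 - (({z.1, z.2} : Finset (Fin n)).card : ℝ) / n) ^ (n - S.card) =
      ∑ z ∈ S.offDiag, (1 - 2 / (n : ℝ)) ^ (n - S.card) := by
    refine Finset.sum_congr rfl fun z hz => ?_
    rw [Finset.card_pair (Finset.mem_offDiag.1 hz).2.2]
    simp
  rw [h]
  have hc : (S.offDiag.card : ℝ) = S.card * S.card - S.card := by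
    rw [Finset.offDiag_card, Nat.cast_sub (Nat.le_mul_self _)]
    push_cast; rfl
  simp only [Finset.card_singleton, Nat.cast_one, Finset.sum_const, nsmul_eq_mul, hc, missProb]
  ring

theorem missProb_nonneg (n k : ℕ) : 0 ≤ missProb n k := by
  refine pow_nonneg ?_ _
  rcases Nat.eq_zero_or_pos n with rfl | h
  · simp
  · have : (1 : ℝ) ≤ n := by exact_mod_cast h
    rw [sub_nonneg, div_le_one (by positivity)]
    exact this

theorem missProb_le_one (n k : ℕ) : missProb n k ≤ 1 := by
  refine pow_le_one₀ ?_ ?_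
  · rcases Nat.eq_zero_or_pos n with rfl | h
    · simp
    · have : (1 : ℝ) ≤ n := by exact_mod_cast h
      rw [sub_nonneg, div_le_one (by positivity)]
      exact this
  · have : 0 ≤ 1 / (n : ℝ) := by positivity
    linarith

theorem one_sub_two_div_pow_le (hn : 2 ≤ n) (k : ℕ) :
    (1 - 2 / (n : ℝ)) ^ (n - k) ≤ missProb n k ^ 2 := by
  have hn' : (2 : ℝ) ≤ n := by exact_mod_cast hn
  rw [missProb, ← pow_mul, mul_comm, pow_mul]
  refine pow_le_pow_left₀ ?_ ?_ _
  · rw [sub_nonneg, div_le_one (by positivity)]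
    exact hn'
  · have : 0 ≤ (1 / (n : ℝ)) ^ 2 := by positivity
    have h2 : 2 / (n : ℝ) = 2 * (1 / n) := by ring
    rw [h2]
    nlinarith

theorem natCast_mul_self_sub_nonneg (k : ℕ) : (0 : ℝ) ≤ k * k - k := by
  have : (k : ℝ) ≤ k * k := by exact_mod_cast Nat.le_mul_self k
  linarith

/-- Negative correlation: two given nodes are both missed with probability `(1 - 2/n)^u ≤ (1 -
1/n)^(2u)`, so both are called with probability at most `m²`. -/
theorem sum_calledCount_mul_sub_le (hn : 2 ≤ n) :
    ∑ call : Fin n → Fin n, ((n : ℝ) ^ n)⁻¹ *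
        ((calledCount S call : ℝ) * calledCount S call - calledCount S call) ≤
      (S.card * S.card - S.card) * (1 - missProb n S.card) ^ 2 := by
  rw [sum_calledCount_mul_sub S (by omega)]
  refine mul_le_mul_of_nonneg_left ?_ (natCast_mul_self_sub_nonneg _)
  have := one_sub_two_div_pow_le hn S.card
  linarith

/-- The expected number of informed nodes at the end of a round that starts with `k` informed
nodes. -/
noncomputable def meanCard (n k : ℕ) : ℝ := k + k * (1 - missProb n k)

/-- Expectations of functions of the number of informed nodes that are bounded by a quadratic
polynomial around the mean. -/
theorem integral_card_le_of_quadratic (hn : 2 ≤ n) (f : ℕ → ℝ) {α β γ : ℝ} (hγ : 0 ≤ γ)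
    (h : ∀ j : ℕ, S.card ≤ j → j ≤ 2 * S.card → j ≤ n →
      f j ≤ α + β * (j - meanCard n S.card) + γ * (j - meanCard n S.card) ^ 2) :
    ∫ S', f S'.card ∂(singlePull n S).toMeasure ≤
      α + γ * (S.card * (1 - missProb n S.card) * missProb n S.card) := by
  rw [integral_card_singlePull]
  set k := S.card
  set m := 1 - missProb n k with hm
  have hm0 : 0 ≤ m := sub_nonneg.2 (missProb_le_one _ _)
  have h1 : ∀ call : Fin n → Fin n, ((n : ℝ) ^ n)⁻¹ * f (k + calledCount S call) ≤
      (α - β * (k * m) + γ * (k * m) ^ 2) * ((n : ℝ) ^ n)⁻¹ +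
      (β - 2 * γ * (k * m) + γ) * (((n : ℝ) ^ n)⁻¹ * calledCount S call) +
      γ * (((n : ℝ) ^ n)⁻¹ *
        ((calledCount S call : ℝ) * calledCount S call - calledCount S call)) := by
    intro call
    have := h (k + calledCount S call) (by omega) (by have := calledCount_le S call; omega)
      (card_add_calledCount_le S call)
    refine (mul_le_mul_of_nonneg_left this (by positivity)).trans_eq ?_
    rw [meanCard]
    push_cast
    ring
  refine (Finset.sum_le_sum fun call _ => h1 call).trans ?_
  rw [Finset.sum_add_distrib, Finset.sum_add_distrib, ← Finset.mul_sum,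
    ← Finset.mul_sum _ fun call => ((n : ℝ) ^ n)⁻¹ * (calledCount S call : ℝ),
    ← Finset.mul_sum _ fun call => ((n : ℝ) ^ n)⁻¹ *
      ((calledCount S call : ℝ) * calledCount S call - calledCount S call),
    sum_inv_pow (by omega), sum_calledCount S (by omega)]
  -- The variance is at most `(k² - k) m² + k m - (k m)² = k m (1 - m)`.
  have h2 := mul_le_mul_of_nonneg_left (sum_calledCount_mul_sub_le S hn) hγ
  change _ ≤ γ * ((k * k - k) * m ^ 2) at h2
  have h3 : missProb n k = 1 - m := by ring
  rw [h3]
  nlinarith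

end Moments

/-! ### Single and pair probabilities by symmetrization -/

section Probabilities

variable {n : ℕ} (S : Finset (Fin n))

theorem integral_singlePull_congr {f g : Finset (Fin n) → ℝ} (h : ∀ S', S ⊆ S' → f S' = g S') :
    ∫ S', f S' ∂(singlePull n S).toMeasure = ∫ S', g S' ∂(singlePull n S).toMeasure := by
  rw [integral_singlePull, integral_singlePull]
  refine Finset.sum_congr rfl fun call _ => ?_
  congr 1
  refine Finset.sum_congr rfl fun acc _ => ?_
  rw [h _ (subset_updateInformed S call acc)]

theorem informProb_eq_integral (R : RoundLaw n) (x : Fin n) :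
    informProb R S x = ∫ S', informedIndicator x S' ∂(R S).toMeasure := by
  have : informedIndicator x = Set.indicator {S' : Finset (Fin n) | x ∈ S'} 1 := by
    ext S'
    simp [informedIndicator, Set.indicator]
  rw [this, integral_indicator_one .of_discrete]
  rfl

theorem informedIndicator_map (σ : Equiv.Perm (Fin n)) (x : Fin n) (S' : Finset (Fin n)) :
    informedIndicator (σ x) (S'.map σ.toEmbedding) = informedIndicator x S' := by
  simp [informedIndicator]

theorem swap_mem_iff {x x' : Fin n} (hx : x ∉ S) (hx' : x' ∉ S) (z : Fin n) :
    Equiv.swap x x' z ∈ S ↔ z ∈ S := by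
  rcases eq_or_ne z x with rfl | h1
  · simp [hx, hx']
  · rcases eq_or_ne z x' with rfl | h2
    · simp [hx, hx']
    · rw [Equiv.swap_apply_of_ne_of_ne h1 h2]

theorem integral_informedIndicator_eq {x x' : Fin n} (hx : x ∉ S) (hx' : x' ∉ S) :
    ∫ S', informedIndicator x S' ∂(singlePull n S).toMeasure =
      ∫ S', informedIndicator x' S' ∂(singlePull n S).toMeasure := by
  rw [← integral_singlePull_map S (Equiv.swap x x') _ (informedIndicator x')]
  · have := informedIndicator_map (Equiv.swap x x') x
    rw [Equiv.swap_apply_left] at this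
    simp_rw [this]
  · exact swap_mem_iff S hx hx'

theorem integral_informedIndicator_mul_eq {x₁ x₂ z₁ z₂ : Fin n} (hx₁ : x₁ ∉ S) (hx₂ : x₂ ∉ S)
    (hx : x₁ ≠ x₂) (hz₁ : z₁ ∉ S) (hz₂ : z₂ ∉ S) (hz : z₁ ≠ z₂) :
    ∫ S', informedIndicator x₁ S' * informedIndicator x₂ S' ∂(singlePull n S).toMeasure =
      ∫ S', informedIndicator z₁ S' * informedIndicator z₂ S' ∂(singlePull n S).toMeasure := by
  -- Two transpositions carry the ordered pair `(x₁, x₂)` to `(z₁, z₂)`; the second moves the image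
  -- `y` of `x₂` and leaves `z₁` alone.
  set y := Equiv.swap x₁ z₁ x₂ with hy
  have hyS : y ∉ S := by rwa [hy, swap_mem_iff S hx₁ hz₁]
  have hyz : y ≠ z₁ := by
    intro h
    rw [hy, Equiv.swap_apply_eq_iff, Equiv.swap_apply_right] at h
    exact hx h.symm
  set σ := (Equiv.swap x₁ z₁).trans (Equiv.swap y z₂) with hσ
  have h1 : σ x₁ = z₁ := by
    rw [hσ, Equiv.trans_apply, Equiv.swap_apply_left, Equiv.swap_apply_of_ne_of_ne hyz.symm hz]
  have h2 : σ x₂ = z₂ := by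
    rw [hσ, Equiv.trans_apply, ← hy, Equiv.swap_apply_left]
  rw [← integral_singlePull_map S σ _
    (fun S' => informedIndicator z₁ S' * informedIndicator z₂ S')]
  · have e1 := informedIndicator_map σ x₁
    have e2 := informedIndicator_map σ x₂
    rw [h1] at e1
    rw [h2] at e2
    simp_rw [e1, e2]
  · intro z
    rw [hσ, Equiv.trans_apply, swap_mem_iff S hyS hz₂, swap_mem_iff S hx₁ hz₁]

theorem sum_informedIndicator (A S' : Finset (Fin n)) :
    ∑ x ∈ A, informedIndicator x S' = (S' ∩ A).card := by
  simp only [informedIndicator, Finset.sum_boole]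
  rw [Finset.filter_mem_eq_inter, Finset.inter_comm]

theorem informedIndicator_mul_self (x : Fin n) (S' : Finset (Fin n)) :
    informedIndicator x S' * informedIndicator x S' = informedIndicator x S' := by
  simp [informedIndicator]

theorem card_inter_compl {S' : Finset (Fin n)} (h : S ⊆ S') :
    ((S' ∩ Sᶜ).card : ℝ) = S'.card - S.card := by
  rw [← Finset.sdiff_eq_inter_compl, Finset.card_sdiff_of_subset h,
    Nat.cast_sub (Finset.card_le_card h)]

theorem cast_card_compl : ((Sᶜ.card : ℕ) : ℝ) = ((n - S.card : ℕ) : ℝ) := by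
  rw [Finset.card_compl, Fintype.card_fin]

/-- The probability that an uninformed node becomes informed. -/
theorem integral_informedIndicator {x : Fin n} (hx : x ∉ S) :
    ((n - S.card : ℕ) : ℝ) * ∫ S', informedIndicator x S' ∂(singlePull n S).toMeasure =
      S.card * (1 - missProb n S.card) := by
  have hn : 0 < n := x.pos
  have h1 : ∑ z ∈ Sᶜ, ∫ S', informedIndicator z S' ∂(singlePull n S).toMeasure =
      ((n - S.card : ℕ) : ℝ) * ∫ S', informedIndicator x S' ∂(singlePull n S).toMeasure := by
    rw [Finset.sum_congr rfl fun z hz =>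
      integral_informedIndicator_eq S (Finset.mem_compl.1 hz) hx, Finset.sum_const, nsmul_eq_mul,
      cast_card_compl]
  rw [← h1, ← integral_finsetSum _ fun _ _ => .of_finite]
  simp_rw [sum_informedIndicator]
  rw [integral_singlePull_congr S (g := fun S' => (fun j : ℕ => (j : ℝ) - S.card) S'.card)
    fun S' h => card_inter_compl S h, integral_card_singlePull S fun j : ℕ => (j : ℝ) - S.card]
  simp only [Nat.cast_add, add_sub_cancel_left]
  exact sum_calledCount S hn

/-- All ordered pairs of distinct uninformed nodes contribute equally, and their product indicators
sum to `N (N - 1)`, whose expectation is bounded by negative correlation. -/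
theorem integral_informedIndicator_mul_le {x₁ x₂ : Fin n} (hx₁ : x₁ ∉ S) (hx₂ : x₂ ∉ S)
    (hx : x₁ ≠ x₂) :
    (((n - S.card : ℕ) : ℝ) * (n - S.card : ℕ) - (n - S.card : ℕ)) *
        ∫ S', informedIndicator x₁ S' * informedIndicator x₂ S' ∂(singlePull n S).toMeasure ≤
      (S.card * S.card - S.card) * (1 - missProb n S.card) ^ 2 := by
  have hn : 2 ≤ n := by
    have h1 := x₁.isLt
    have h2 := x₂.isLt
    have h3 : (x₁ : ℕ) ≠ x₂ := fun h => hx (Fin.ext h)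
    omega
  have h1 : ∑ z ∈ Sᶜ.offDiag, ∫ S', informedIndicator z.1 S' * informedIndicator z.2 S'
      ∂(singlePull n S).toMeasure = (((n - S.card : ℕ) : ℝ) * (n - S.card : ℕ) -
      (n - S.card : ℕ)) * ∫ S', informedIndicator x₁ S' * informedIndicator x₂ S'
        ∂(singlePull n S).toMeasure := by
    rw [Finset.sum_congr rfl fun z hz => integral_informedIndicator_mul_eq S
      (Finset.mem_compl.1 (Finset.mem_offDiag.1 hz).1)
      (Finset.mem_compl.1 (Finset.mem_offDiag.1 hz).2.1) (Finset.mem_offDiag.1 hz).2.2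
      hx₁ hx₂ hx, Finset.sum_const, nsmul_eq_mul, Finset.offDiag_card,
      Nat.cast_sub (Nat.le_mul_self _), Nat.cast_mul, cast_card_compl]
  have h2 : ∀ S', S ⊆ S' →
      ∑ z ∈ Sᶜ.offDiag, informedIndicator z.1 S' * informedIndicator z.2 S' =
      (fun j : ℕ => ((j : ℝ) - S.card) * (j - S.card) - (j - S.card)) S'.card := by
    intro S' h
    have e := congrArg₂ (· * ·) (sum_informedIndicator Sᶜ S') (sum_informedIndicator Sᶜ S')
    rw [Finset.sum_mul_sum, ← Finset.sum_product', ← Finset.diag_union_offDiag,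
      Finset.sum_union (Finset.disjoint_diag_offDiag _), Finset.sum_diag] at e
    simp_rw [informedIndicator_mul_self] at e
    rw [sum_informedIndicator, card_inter_compl S h] at e
    linarith
  rw [← h1, ← integral_finsetSum _ fun _ _ => .of_finite, integral_singlePull_congr S h2,
    integral_card_singlePull S fun j : ℕ => ((j : ℝ) - S.card) * (j - S.card) - (j - S.card)]
  simp only [Nat.cast_add, add_sub_cancel_left]
  exact sum_calledCount_mul_sub_le S hn

end Probabilities

/-! ### Estimates of the probability of not being called -/

section MissProb

variable {n k : ℕ}

theorem exp_neg_one_le_missProb (hn : 2 ≤ n) (hk : 1 ≤ k) : Real.exp (-1) ≤ missProb n k := by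
  have hn' : (2 : ℝ) ≤ n := by exact_mod_cast hn
  have h0 : (0 : ℝ) ≤ 1 - 1 / n := by
    rw [sub_nonneg, div_le_one (by positivity)]
    linarith
  have h1 : 1 - 1 / (n : ℝ) ≤ 1 := by
    have : 0 ≤ 1 / (n : ℝ) := by positivity
    linarith
  -- The `(n - 1)`-th power of this is the claim for exponent `n - 1`, the largest possible because
  -- at least one node is informed.
  have h2 : Real.exp (-(1 / ((n : ℝ) - 1))) ≤ 1 - 1 / n := by
    have h3 := Real.add_one_le_exp (1 / ((n : ℝ) - 1))
    have h4 : (0 : ℝ) < n - 1 := by linarith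
    rw [Real.exp_neg, inv_le_comm₀ (Real.exp_pos _)]
    · refine le_trans (le_of_eq ?_) h3
      field_simp
      ring
    · rw [sub_pos, div_lt_one (by positivity)]
      linarith
  calc Real.exp (-1) = Real.exp (-(1 / ((n : ℝ) - 1))) ^ (n - 1) := by
        rw [← Real.exp_nat_mul, Nat.cast_sub (by omega)]
        congr 1
        have : (n : ℝ) - 1 ≠ 0 := by linarith
        push_cast
        field_simp
    _ ≤ (1 - 1 / (n : ℝ)) ^ (n - 1) := pow_le_pow_left₀ (Real.exp_pos _).le h2 _
    _ ≤ _ := pow_le_pow_of_le_one h0 h1 (by omega)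

theorem missProb_le_exp (hn : 1 ≤ n) :
    missProb n k ≤ Real.exp (-((n - k : ℕ) / n)) := by
  have hn' : (1 : ℝ) ≤ n := by exact_mod_cast hn
  have h2 := Real.add_one_le_exp (-(1 / (n : ℝ)))
  have h0 : (0 : ℝ) ≤ 1 - 1 / n := by
    rw [sub_nonneg, div_le_one (by positivity)]
    linarith
  calc missProb n k ≤ Real.exp (-(1 / (n : ℝ))) ^ (n - k) :=
        pow_le_pow_left₀ h0 (by linarith) _
    _ = _ := by
        rw [← Real.exp_nat_mul]
        congr 1
        ring

theorem one_sub_missProb_le (hn : 1 ≤ n) : 1 - missProb n k ≤ (n - k : ℕ) / n := by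
  have hn' : (1 : ℝ) ≤ n := by exact_mod_cast hn
  have h1 : 1 / (n : ℝ) ≤ 1 := by
    rw [div_le_one (by positivity)]
    exact hn'
  have h := one_add_mul_le_pow (a := -(1 / (n : ℝ))) (by linarith) (n - k)
  rw [← sub_eq_add_neg] at h
  rw [missProb]
  have e : ((n - k : ℕ) : ℝ) * -(1 / n) = -((n - k : ℕ) / n) := by ring
  rw [e] at h
  linarith

theorem exp_neg_le_one_sub_add {x : ℝ} (hx : 0 ≤ x) : Real.exp (-x) ≤ 1 - x + x ^ 2 / 2 := by
  have h := Real.quadratic_le_exp_of_nonneg hx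
  rw [Real.exp_neg, inv_le_comm₀ (Real.exp_pos _) (by nlinarith [sq_nonneg (x - 1)])]
  refine le_trans ?_ h
  rw [inv_le_iff_one_le_mul₀ (by nlinarith [sq_nonneg (x - 1)])]
  nlinarith [sq_nonneg (x ^ 2)]

theorem le_one_sub_missProb (hn : 1 ≤ n) :
    ((n - k : ℕ) / n : ℝ) - ((n - k : ℕ) / n : ℝ) ^ 2 / 2 ≤ 1 - missProb n k := by
  have h1 := missProb_le_exp (k := k) hn
  have h2 := exp_neg_le_one_sub_add (x := ((n - k : ℕ) / n : ℝ)) (by positivity)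
  linarith

theorem div_one_add_le_one_sub_missProb (hn : 1 ≤ n) {x : ℝ} (hx : 0 ≤ x)
    (h : x ≤ (n - k : ℕ) / n) : x / (1 + x) ≤ 1 - missProb n k := by
  have h1 := missProb_le_exp (k := k) hn
  have h2 : Real.exp (-((n - k : ℕ) / n)) ≤ Real.exp (-x) := Real.exp_le_exp.2 (by linarith)
  have h3 : Real.exp (-x) ≤ 1 / (1 + x) := by
    rw [Real.exp_neg, ← one_div]
    exact one_div_le_one_div_of_le (by linarith) (by linarith [Real.add_one_le_exp x])
  have h4 : x / (1 + x) = 1 - 1 / (1 + x) := by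
    field_simp
    ring
  linarith

theorem exp_neg_one_lt : Real.exp (-1) < 1 / 2 := by
  rw [Real.exp_neg, ← one_div]
  exact one_div_lt_one_div_of_lt (by norm_num) (by linarith [Real.exp_one_gt_d9])

/-- With `x = k/n ≤ 1/2`, the bound `e^(-1+x) ≤ e⁻¹ (1 + 2x)` suffices because `2 e⁻¹ < 1`. -/
theorem missProb_le_add (hn : 1 ≤ n) (hk : 2 * k ≤ n) :
    missProb n k ≤ Real.exp (-1) + k / n := by
  have hn' : (1 : ℝ) ≤ n := by exact_mod_cast hn
  have hk' : 2 * (k : ℝ) ≤ n := by exact_mod_cast hk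
  have h1 := missProb_le_exp (k := k) hn
  rw [Nat.cast_sub (by omega)] at h1
  set x := (k : ℝ) / n with hx
  have hx0 : 0 ≤ x := by positivity
  have hx1 : x ≤ 1 / 2 := by
    rw [hx, div_le_iff₀ (by positivity)]
    linarith
  have e : -(((n : ℝ) - k) / n) = -1 + x := by
    rw [hx]
    field_simp
    ring
  rw [e, Real.exp_add] at h1
  have h2 : Real.exp x ≤ 1 + 2 * x := by
    have h3 : 1 - x ≤ Real.exp (-x) := Real.one_sub_le_exp_neg x
    rw [Real.exp_neg] at h3
    have h4 : Real.exp x ≤ (1 - x)⁻¹ := by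
      rw [le_inv_comm₀ (Real.exp_pos _) (by linarith)]
      exact h3
    refine h4.trans ?_
    rw [inv_le_iff_one_le_mul₀ (by linarith)]
    nlinarith
  have h5 := exp_neg_one_lt
  have h6 := mul_le_mul_of_nonneg_left h2 (Real.exp_pos (-1)).le
  nlinarith

end MissProb

/-! ### Homogeneity, covariance numbers and the four growth and shrinking conditions -/

section Conditions

/-- The probability that an uninformed node becomes informed in a round that starts with `k`
informed nodes. -/
noncomputable def successProb (n k : ℕ) : ℝ := k / (n - k : ℕ) * (1 - missProb n k)

theorem cast_sub_card_pos {n : ℕ} {S : Finset (Fin n)} {x : Fin n} (hx : x ∉ S) :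
    (1 : ℝ) ≤ (n - S.card : ℕ) := by
  have h : S.card < n := by
    simpa using Finset.card_lt_univ_of_notMem hx
  exact_mod_cast (show 1 ≤ n - S.card by omega)

theorem integral_informedIndicator_eq_successProb {n : ℕ} {S : Finset (Fin n)} {x : Fin n}
    (hx : x ∉ S) :
    ∫ S', informedIndicator x S' ∂(singlePull n S).toMeasure = successProb n S.card := by
  have h := integral_informedIndicator S hx
  have h0 := cast_sub_card_pos hx
  rw [successProb]
  field_simp
  linarith

theorem isHomogeneous_singlePull (n : ℕ) : IsHomogeneous (singlePull n) (successProb n) :=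
  ⟨fun S _ h => subset_of_mem_support S h, fun S _ x hx => by
    rw [informProb_eq_integral, integral_informedIndicator_eq_successProb hx]⟩

theorem covNumber_le {n : ℕ} {R : RoundLaw n} {k : ℕ} {B : ℝ} (hB : 0 ≤ B)
    (h : ∀ S : Finset (Fin n), S.card = k → ∀ x₁ ∉ S, ∀ x₂ ∉ S, x₁ ≠ x₂ →
      cov[informedIndicator x₁, informedIndicator x₂; (R S).toMeasure] ≤ B) :
    covNumber R k ≤ B := by
  unfold covNumber
  by_cases hex : ∃ S : Finset (Fin n), S.card = k ∧ ∃ x₁ ∉ S, ∃ x₂ ∉ S, x₁ ≠ x₂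
  · obtain ⟨S, hS, x₁, hx₁, x₂, hx₂, hx⟩ := hex
    exact csInf_le ⟨_, fun c hc => hc S hS x₁ hx₁ x₂ hx₂ hx⟩ h
  · push Not at hex
    -- Without a pair every real is an upper bound, and `sInf` of the whole line is `0` by
    -- convention; this is where `0 ≤ B` is needed.
    rw [Set.eq_univ_of_forall (s := {c : ℝ | _}) fun c S hS x₁ hx₁ x₂ hx₂ hx =>
      absurd (hex S hS x₁ hx₁ x₂ hx₂) hx, Real.sInf_univ]
    exact hB

theorem two_le_sub_card {n : ℕ} {S : Finset (Fin n)} {x₁ x₂ : Fin n} (hx₁ : x₁ ∉ S)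
    (hx₂ : x₂ ∉ S) (hx : x₁ ≠ x₂) : 2 ≤ n - S.card := by
  have h : ({x₁, x₂} : Finset (Fin n)) ⊆ Sᶜ := by
    intro z hz
    rcases Finset.mem_insert.1 hz with rfl | hz
    · simpa using hx₁
    · rw [Finset.mem_singleton.1 hz]
      simpa using hx₂
  have := Finset.card_le_card h
  rwa [Finset.card_pair hx, Finset.card_compl, Fintype.card_fin] at this

/-- The pair bound minus `p_k²`. The sign is that of `k - u`, so covariances are nonpositive while
at most half of the nodes are informed, and the growth conditions hold with `c = 0`. -/
theorem cov_singlePull_le {n : ℕ} {S : Finset (Fin n)} {x₁ x₂ : Fin n} (hx₁ : x₁ ∉ S)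
    (hx₂ : x₂ ∉ S) (hx : x₁ ≠ x₂) :
    cov[informedIndicator x₁, informedIndicator x₂; (singlePull n S).toMeasure] ≤
      (1 - missProb n S.card) ^ 2 * S.card * (S.card - (n - S.card : ℕ)) /
        (((n - S.card : ℕ) : ℝ) ^ 2 * ((n - S.card : ℕ) - 1)) := by
  have hm : ∀ x, MemLp (informedIndicator x) 2 (singlePull n S).toMeasure := fun x =>
    MemLp.of_discrete
  rw [covariance_eq_sub (hm x₁) (hm x₂), integral_informedIndicator_eq_successProb hx₁,
    integral_informedIndicator_eq_successProb hx₂]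
  have h := integral_informedIndicator_mul_le S hx₁ hx₂ hx
  simp only [Pi.mul_apply]
  set I := ∫ S', informedIndicator x₁ S' * informedIndicator x₂ S' ∂(singlePull n S).toMeasure
  have hu : 2 ≤ n - S.card := two_le_sub_card hx₁ hx₂ hx
  rw [successProb]
  set k : ℝ := (S.card : ℝ)
  have hu' : (2 : ℝ) ≤ (n - S.card : ℕ) := by exact_mod_cast hu
  set u : ℝ := ((n - S.card : ℕ) : ℝ)
  set m := 1 - missProb n S.card
  have h1 : I ≤ (k * k - k) * m ^ 2 / (u * u - u) := by
    rw [le_div_iff₀ (by nlinarith)]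
    linarith
  have h2 : (k * k - k) * m ^ 2 / (u * u - u) - k / u * m * (k / u * m) =
      m ^ 2 * k * (k - u) / (u ^ 2 * (u - 1)) := by
    have e1 : u * u - u = u * (u - 1) := by ring
    have e2 : u - 1 ≠ 0 := by linarith
    rw [e1]
    field_simp
    ring
  linarith

theorem covNumber_singlePull_nonpos {n k : ℕ} (h : 2 * k ≤ n) :
    covNumber (singlePull n) k ≤ 0 := by
  refine covNumber_le le_rfl fun S hS x₁ hx₁ x₂ hx₂ hx => (cov_singlePull_le hx₁ hx₂ hx).trans ?_
  have h1 := cast_sub_card_pos hx₁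
  rw [hS] at h1 ⊢
  have h2 : (k : ℝ) ≤ (n - k : ℕ) := by exact_mod_cast (show k ≤ n - k by omega)
  refine div_nonpos_of_nonpos_of_nonneg ?_ ?_
  · exact mul_nonpos_of_nonneg_of_nonpos (by positivity) (by linarith)
  · exact mul_nonneg (by positivity) (by linarith)

theorem covNumber_singlePull_le {n u : ℕ} (hu : 1 ≤ u) (hun : u < n) :
    covNumber (singlePull n) (n - u) ≤ 2 * (n / (u : ℝ) ^ 2) := by
  refine covNumber_le (by positivity) fun S hS x₁ hx₁ x₂ hx₂ hx =>
    (cov_singlePull_le hx₁ hx₂ hx).trans ?_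
  have hu2 : 2 ≤ n - S.card := two_le_sub_card hx₁ hx₂ hx
  have e : n - S.card = u := by omega
  have hm := one_sub_missProb_le (n := n) (k := S.card) (by omega)
  have hm0 := sub_nonneg.2 (missProb_le_one n S.card)
  rw [e] at hm hu2 ⊢
  have hk : (S.card : ℝ) = n - u := by
    rw [hS, Nat.cast_sub hun.le]
  rw [hk]
  have hu' : (2 : ℝ) ≤ u := by exact_mod_cast hu2
  have hun' : (u : ℝ) < n := by exact_mod_cast hun
  have hn : (0 : ℝ) < n := by linarith
  set m := 1 - missProb n S.card
  -- So the numerator is at most `m² n² ≤ u²`, and `u² ≤ n u ≤ 2 n (u - 1)` since `2 ≤ u ≤ n`.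
  have h1 : m ^ 2 ≤ (u / n : ℝ) ^ 2 := pow_le_pow_left₀ hm0 hm 2
  rw [div_le_iff₀ (mul_pos (by positivity) (by linarith))]
  have h2 : 2 * (n / (u : ℝ) ^ 2) * ((u : ℝ) ^ 2 * (u - 1)) = 2 * n * (u - 1) := by
    field_simp
  rw [h2]
  have h3 : m ^ 2 * (n - u) * (n - u - u) ≤ m ^ 2 * n ^ 2 := by
    rw [mul_assoc]
    refine mul_le_mul_of_nonneg_left ?_ (by positivity)
    nlinarith
  have h4 : m ^ 2 * (n : ℝ) ^ 2 ≤ (u : ℝ) ^ 2 := by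
    calc m ^ 2 * (n : ℝ) ^ 2 ≤ (u / n : ℝ) ^ 2 * (n : ℝ) ^ 2 := by gcongr
      _ = (u : ℝ) ^ 2 := by field_simp
  nlinarith

theorem posBounded_const {c : ℝ} (hc : 0 < c) : PosBounded fun _ => c :=
  ⟨c, c, hc, fun _ => ⟨le_rfl, le_rfl⟩⟩

theorem half_lt_one_sub_inv_exp : 1 / 2 < 1 - 1 / Real.exp 1 := by
  have := exp_neg_one_lt
  rw [Real.exp_neg, ← one_div] at this
  linarith

theorem upperExpGrowth_singlePull :
    UpperExpGrowth singlePull successProb fun _ => 1 - 1 / Real.exp 1 := by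
  have hγ := half_lt_one_sub_inv_exp
  refine ⟨posBounded_const (by linarith), 2, 0, 0, 1 / 4, by norm_num, le_rfl, le_rfl,
    by norm_num, by norm_num, by norm_num, 2, fun n hn k hk hkn => ?_⟩
  have hkn' : 4 * k < n := by
    have : (4 * k : ℝ) < n := by linarith
    exact_mod_cast this
  refine ⟨?_, by simpa using covNumber_singlePull_nonpos (by omega)⟩
  have hm := missProb_le_add (n := n) (k := k) (by omega) (by omega)
  rw [Real.exp_neg, ← one_div] at hm
  set γ := 1 - 1 / Real.exp 1 with hγd
  have hn0 : (0 : ℝ) < n := by exact_mod_cast (by omega : 0 < n)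
  have hk0 : (0 : ℝ) < k := by exact_mod_cast hk
  have hu0 : (0 : ℝ) < (n - k : ℕ) := by exact_mod_cast (by omega : 0 < n - k)
  have h1 : (k / n : ℝ) ≤ k / (n - k : ℕ) := by
    refine div_le_div_of_nonneg_left hk0.le hu0 ?_
    exact_mod_cast Nat.sub_le _ _
  have hx : (0 : ℝ) < k / n := by positivity
  have hx4 : (k / n : ℝ) < 1 / 4 := by
    rw [div_lt_iff₀ hn0]
    exact hkn
  rw [successProb]
  calc γ * (k / n : ℝ) * (1 - 2 * (k / n) - 0 / Real.log n) =
        (k / n) * (γ - 2 * γ * (k / n)) := by ring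
    -- The choice `a = 2` works because `γ > 1/2`.
    _ ≤ (k / n) * (γ - k / n) := by
        gcongr
        nlinarith
    _ ≤ k / (n - k : ℕ) * (1 - missProb n k) :=
        mul_le_mul h1 (by linarith) (by linarith) (by positivity)

theorem lowerExpGrowth_singlePull :
    LowerExpGrowth singlePull successProb fun _ => 1 - 1 / Real.exp 1 := by
  have hγ := half_lt_one_sub_inv_exp
  refine ⟨posBounded_const (by linarith), 2, 0, 0, 1 / 4, by norm_num, le_rfl, le_rfl,
    by norm_num, by norm_num, 2, fun n hn k hk hkn => ?_⟩
  have hkn' : 4 * k < n := by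
    have : (4 * k : ℝ) < n := by linarith
    exact_mod_cast this
  refine ⟨?_, by simpa using covNumber_singlePull_nonpos (by omega)⟩
  have hm := exp_neg_one_le_missProb (n := n) (k := k) hn hk
  rw [Real.exp_neg, ← one_div] at hm
  set γ := 1 - 1 / Real.exp 1 with hγd
  have hn0 : (0 : ℝ) < n := by exact_mod_cast (by omega : 0 < n)
  have hk0 : (0 : ℝ) < k := by exact_mod_cast hk
  have hu : ((n - k : ℕ) : ℝ) = n - k := Nat.cast_sub (by omega)
  have h1 : (k / (n - k : ℕ) : ℝ) ≤ k / n * (1 + 2 * (k / n)) := by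
    rw [hu, div_le_iff₀ (by linarith)]
    have : (k / n : ℝ) * (1 + 2 * (k / n)) * (n - k) = k * (1 + (k / n) * (1 - 2 * (k / n))) := by
      field_simp
      ring
    rw [this]
    have hx : (0 : ℝ) < k / n := by positivity
    have hx4 : (k / n : ℝ) < 1 / 4 := by
      rw [div_lt_iff₀ hn0]
      exact hkn
    have : 0 ≤ (k / n : ℝ) * (1 - 2 * (k / n)) := mul_nonneg hx.le (by linarith)
    nlinarith
  rw [successProb]
  calc k / (n - k : ℕ) * (1 - missProb n k) ≤ k / n * (1 + 2 * (k / n)) * γ :=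
        mul_le_mul h1 (by linarith) (sub_nonneg.2 (missProb_le_one _ _)) (by positivity)
    _ = _ := by ring

theorem rpow_two_sub_one (x : ℝ) : x ^ ((2 : ℝ) - 1) = x := by
  norm_num

theorem upperDoubleExpShrinking_singlePull :
    UpperDoubleExpShrinking singlePull successProb 2 := by
  refine ⟨by norm_num, 3 / 2, 2, 1 / 2, by norm_num, by norm_num, by norm_num, by norm_num, ?_,
    2, fun n hn u hu hun hug => ⟨?_, covNumber_singlePull_le hu hun⟩⟩
  · rw [rpow_two_sub_one]
    norm_num
  rw [rpow_two_sub_one, successProb]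
  have hm := le_one_sub_missProb (n := n) (k := n - u) (by omega)
  rw [Nat.sub_sub_self hun.le] at hm ⊢
  have hn0 : (0 : ℝ) < n := by exact_mod_cast (by omega : 0 < n)
  have hu0 : (0 : ℝ) < u := by exact_mod_cast hu
  rw [Nat.cast_sub hun.le]
  have h1 : ((n - u : ℝ) / u) * (u / n - (u / n) ^ 2 / 2) ≤
      (n - u : ℝ) / u * (1 - missProb n (n - u)) :=
    mul_le_mul_of_nonneg_left hm (div_nonneg (by linarith) hu0.le)
  -- The source of `a = 3/2`; with `g = 1/2` this leaves `a g = 3/4 < 1`.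
  have h2 : ((n - u : ℝ) / u) * (u / n - (u / n) ^ 2 / 2) =
      1 - 3 / 2 * (u / n) + (u / n) ^ 2 / 2 := by
    field_simp
    ring
  have h3 : 0 ≤ (u / n : ℝ) ^ 2 := by positivity
  linarith

theorem lowerDoubleExpShrinking_singlePull :
    LowerDoubleExpShrinking singlePull successProb 2 := by
  refine ⟨by norm_num, 1, 2, 1 / 2, by norm_num, by norm_num, by norm_num, by norm_num, ?_,
    2, fun n hn u hu hun hug => ⟨?_, covNumber_singlePull_le hu hun⟩⟩
  · rw [rpow_two_sub_one]
    norm_num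
  rw [rpow_two_sub_one, successProb]
  have hm := one_sub_missProb_le (n := n) (k := n - u) (by omega)
  rw [Nat.sub_sub_self hun.le] at hm ⊢
  have hn0 : (0 : ℝ) < n := by exact_mod_cast (by omega : 0 < n)
  have hu0 : (0 : ℝ) < u := by exact_mod_cast hu
  rw [Nat.cast_sub hun.le]
  have h1 : (n - u : ℝ) / u * (1 - missProb n (n - u)) ≤ ((n - u : ℝ) / u) * (u / n) :=
    mul_le_mul_of_nonneg_left hm (div_nonneg (by linarith) hu0.le)
  have h2 : ((n - u : ℝ) / u) * (u / n) = 1 - u / n := by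
    field_simp
  linarith

end Conditions

/-! ### Drift for potentials that depend on the number of informed nodes -/

section CardDrift

variable {n : ℕ}

theorem le_integral_card_of_quadratic (S : Finset (Fin n)) (hn : 2 ≤ n) (f : ℕ → ℝ) {α β γ : ℝ}
    (hγ : 0 ≤ γ) (h : ∀ j : ℕ, S.card ≤ j → j ≤ 2 * S.card → j ≤ n →
      α + β * (j - meanCard n S.card) - γ * (j - meanCard n S.card) ^ 2 ≤ f j) :
    α - γ * (S.card * (1 - missProb n S.card) * missProb n S.card) ≤
      ∫ S', f S'.card ∂(singlePull n S).toMeasure := by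
  have := integral_card_le_of_quadratic S hn (fun j => -f j) (α := -α) (β := -β) hγ
    fun j h1 h2 h3 => by linarith [h j h1 h2 h3]
  rw [integral_neg] at this
  linarith

theorem support_singlePull_subset (S : Finset (Fin n)) :
    ∀ S' ∈ (singlePull n S).support, S ⊆ S' := fun _ h => subset_of_mem_support S h

theorem expectedSpreadingTime_singlePull_le (v : Fin n) (h : ℕ → ℝ)
    (h0 : ∀ k, 1 ≤ k → k ≤ n → 0 ≤ h k)
    (hd : ∀ S : Finset (Fin n), 1 ≤ S.card → S.card < n →
      ∫ S', h S'.card ∂(singlePull n S).toMeasure ≤ h S.card - 1) :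
    expectedSpreadingTime (singlePull n) v ≤ ENNReal.ofReal (h 1) := by
  have key := expectedSpreadingTime_le_of_drift (R := singlePull n) v support_singlePull_subset
    -- No round informs anyone when nobody is informed; the value `∞` makes the drift condition
    -- trivial in this state, which is never reached from `{v}`.
    (fun S => if S.card = 0 then ∞ else ENNReal.ofReal (h S.card)) ?_
  · simpa using key
  intro S
  by_cases hS : S.card = 0
  · simp [hS]
  have hS1 : 1 ≤ S.card := by omega
  have hle : ∀ S' : Finset (Fin n), S'.card ≤ n := fun S' => by simpa using S'.card_le_univ
  have hae := ae_subset (R := singlePull n) support_singlePull_subset S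
  have h1 : ∫⁻ S', (if S'.card = 0 then ∞ else ENNReal.ofReal (h S'.card))
      ∂(singlePull n S).toMeasure =
      ENNReal.ofReal (∫ S', h S'.card ∂(singlePull n S).toMeasure) := by
    rw [ofReal_integral_eq_lintegral_ofReal .of_finite]
    · refine lintegral_congr_ae ?_
      filter_upwards [hae] with S' hS'
      have := Finset.card_le_card hS'
      rw [if_neg (by omega)]
    · filter_upwards [hae] with S' hS'
      have := Finset.card_le_card hS'
      exact h0 _ (by omega) (hle S')
  rw [h1, if_neg hS]
  by_cases hSn : S.card < n
  · rw [if_pos hSn]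
    have hint : 0 ≤ ∫ S', h S'.card ∂(singlePull n S).toMeasure := by
      refine integral_nonneg_of_ae ?_
      filter_upwards [hae] with S' hS'
      have := Finset.card_le_card hS'
      exact h0 _ (by omega) (hle S')
    rw [← ENNReal.ofReal_one, ← ENNReal.ofReal_add zero_le_one hint]
    exact ENNReal.ofReal_le_ofReal (by linarith [hd S hS1 hSn])
  · rw [if_neg hSn, zero_add]
    refine ENNReal.ofReal_le_ofReal (le_of_eq ?_)
    rw [integral_congr_ae (g := fun _ => h S.card)]
    · simp
    · filter_upwards [hae] with S' hS'
      have := Finset.card_le_card hS'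
      have := hle S'
      congr 1
      omega

theorem le_expectedSpreadingTime_singlePull (v : Fin n)
    (hfin : expectedSpreadingTime (singlePull n) v ≠ ∞) (h : ℕ → ℝ) {c : ℝ} (hc : 0 ≤ c)
    (h0 : ∀ k, 0 ≤ h k) (hfull : h n = 0)
    (hd : ∀ S : Finset (Fin n), S.card < n →
      h S.card ≤ c + ∫ S', h S'.card ∂(singlePull n S).toMeasure) :
    h 1 ≤ c * (expectedSpreadingTime (singlePull n) v).toReal := by
  have hle : ∀ S' : Finset (Fin n), S'.card ≤ n := fun S' => by simpa using S'.card_le_univ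
  have hz : ∀ S : Finset (Fin n), ¬S.card < n → h S.card = 0 := by
    intro S hS
    rw [show S.card = n from le_antisymm (hle S) (not_lt.1 hS), hfull]
  have key := le_expectedSpreadingTime_of_drift (R := singlePull n) v support_singlePull_subset
    hfin (fun S => ENNReal.ofReal (h S.card)) (c := ENNReal.ofReal c)
    (M := ENNReal.ofReal (∑ k ∈ Finset.range n, h k)) ENNReal.ofReal_ne_top ?_ ?_
  · rw [Finset.card_singleton] at key
    have := ENNReal.toReal_mono (ENNReal.mul_ne_top ENNReal.ofReal_ne_top hfin) key
    rwa [ENNReal.toReal_mul, ENNReal.toReal_ofReal (h0 1), ENNReal.toReal_ofReal hc] at this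
  · intro S
    by_cases hS : S.card < n
    · rw [if_pos hS, mul_one]
      exact ENNReal.ofReal_le_ofReal
        (Finset.single_le_sum (fun k _ => h0 k) (Finset.mem_range.2 hS))
    · simp [hz S hS]
  · intro S
    rw [← ofReal_integral_eq_lintegral_ofReal .of_finite (Filter.Eventually.of_forall
      fun _ => h0 _)]
    by_cases hS : S.card < n
    · rw [if_pos hS, mul_one, ← ENNReal.ofReal_add hc (integral_nonneg fun _ => h0 _)]
      exact ENNReal.ofReal_le_ofReal (hd S hS)
    · simp [hz S hS]

end CardDrift

/-! ### Numerical bounds for the growth base -/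

section Constants

theorem three_halves_lt_growthBase : 3 / 2 < 2 - 1 / Real.exp 1 := by
  linarith [half_lt_one_sub_inv_exp]

theorem third_le_log_growthBase : 1 / 3 ≤ Real.log (2 - 1 / Real.exp 1) := by
  have h := three_halves_lt_growthBase
  have h1 := Real.one_sub_inv_le_log_of_pos (show (0 : ℝ) < 2 - 1 / Real.exp 1 by linarith)
  have h2 : (2 - 1 / Real.exp 1)⁻¹ ≤ (3 / 2 : ℝ)⁻¹ := inv_anti₀ (by norm_num) h.le
  norm_num at h2 ⊢
  norm_num at h1
  linarith

end Constants

/-! ### Upper potential of the shrinking phase -/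

section UpperPotential

variable {n : ℕ}

/-- `log (n / (2 u))`, truncated from below at `log 8`. -/
noncomputable def shrinkLog (n u : ℕ) : ℝ := Real.log (max ((n : ℝ) / (2 * u)) 8)

theorem two_le_log_eight : 2 ≤ Real.log 8 := by
  rw [show (8 : ℝ) = 2 ^ 3 by norm_num, Real.log_pow]
  push_cast
  linarith [Real.log_two_gt_d9]

theorem two_le_shrinkLog (n u : ℕ) : 2 ≤ shrinkLog n u :=
  two_le_log_eight.trans (Real.log_le_log (by norm_num) (le_max_right _ _))

theorem log_two_le_log (hn : 2 ≤ n) : Real.log 2 ≤ Real.log n :=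
  Real.log_le_log (by norm_num) (by exact_mod_cast hn)

theorem log_pos_of_two_le (hn : 2 ≤ n) : 0 < Real.log n :=
  Real.log_pos (by exact_mod_cast (by omega : 1 < n))

theorem shrinkLog_le (hn : 2 ≤ n) {u : ℕ} (hu : 1 ≤ u) : shrinkLog n u ≤ 3 * Real.log n := by
  have hn0 : (0 : ℝ) < n := by exact_mod_cast (by omega : 0 < n)
  have hu1 : (1 : ℝ) ≤ u := by exact_mod_cast hu
  have hL := log_pos_of_two_le hn
  rcases le_total ((n : ℝ) / (2 * u)) 8 with h | h
  · rw [shrinkLog, max_eq_right h, show (8 : ℝ) = 2 ^ 3 by norm_num, Real.log_pow]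
    push_cast
    linarith [log_two_le_log hn]
  · rw [shrinkLog, max_eq_left h]
    have : Real.log ((n : ℝ) / (2 * u)) ≤ Real.log n :=
      Real.log_le_log (by positivity) (div_le_self hn0.le (by linarith))
    linarith

theorem shrinkLog_anti {u u' : ℕ} (hu' : 1 ≤ u') (h : u' ≤ u) :
    shrinkLog n u ≤ shrinkLog n u' := by
  have hu1 : (1 : ℝ) ≤ u' := by exact_mod_cast hu'
  have h1 : (u' : ℝ) ≤ u := by exact_mod_cast h
  refine Real.log_le_log (lt_of_lt_of_le (by norm_num) (le_max_right _ _)) ?_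
  refine max_le_max_right _ (div_le_div_of_nonneg_left (by positivity) (by linarith) (by linarith))

/-- Upper potential of the shrinking phase, as a function of the number `u` of uninformed
nodes. -/
noncomputable def shrinkUpper (n u : ℕ) : ℝ :=
  if u = 0 then 0 else 3 + Real.logb 2 (Real.log n / shrinkLog n u) + 6 / shrinkLog n u

/-- The truncation of `shrinkLog` can make the logarithm negative, but never below `-2`, and the
summand 3 covers this. Positivity makes the potential monotone down to its value 0 at `u = 0`. -/
theorem one_le_shrinkUpper (hn : 2 ≤ n) {u : ℕ} (hu : 1 ≤ u) : 1 ≤ shrinkUpper n u := by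
  have h1 := two_le_shrinkLog n u
  have h2 := shrinkLog_le hn hu
  have h3 : Real.logb 2 (1 / 4) ≤ Real.logb 2 (Real.log n / shrinkLog n u) := by
    refine Real.logb_le_logb_of_le (by norm_num) (by norm_num) ?_
    rw [div_le_div_iff₀ (by norm_num) (by linarith)]
    linarith [log_pos_of_two_le hn]
  have h4 : Real.logb 2 (1 / 4) = -2 := by
    rw [show (1 / 4 : ℝ) = 2 ^ (-2 : ℝ) by norm_num [Real.rpow_neg]]
    exact Real.logb_rpow (by norm_num) (by norm_num)
  have h5 : 0 ≤ 6 / shrinkLog n u := by positivity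
  rw [shrinkUpper, if_neg (by omega)]
  linarith

theorem shrinkUpper_mono (hn : 2 ≤ n) {u u' : ℕ} (h : u' ≤ u) :
    shrinkUpper n u' ≤ shrinkUpper n u := by
  rcases Nat.eq_zero_or_pos u' with rfl | hu'
  · rcases Nat.eq_zero_or_pos u with rfl | hu
    · exact le_rfl
    · have := one_le_shrinkUpper hn hu
      rw [shrinkUpper, if_pos rfl]
      linarith
  · rw [shrinkUpper, shrinkUpper, if_neg (by omega), if_neg (by omega)]
    have h1 := two_le_shrinkLog n u
    have h2 := shrinkLog_anti (n := n) hu' h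
    have hL := log_pos_of_two_le hn
    have h3 : Real.logb 2 (Real.log n / shrinkLog n u') ≤
        Real.logb 2 (Real.log n / shrinkLog n u) :=
      Real.logb_le_logb_of_le (by norm_num) (div_pos hL (by linarith))
        (div_le_div_of_nonneg_left hL.le (by linarith) h2)
    have h4 : 6 / shrinkLog n u' ≤ 6 / shrinkLog n u :=
      div_le_div_of_nonneg_left (by norm_num) (by linarith) h2
    linarith

theorem shrinkLog_of_le {u : ℕ} (hu : 1 ≤ u) (h : 16 * u ≤ n) :
    shrinkLog n u = Real.log (n / (2 * u)) := by
  have hu1 : (1 : ℝ) ≤ u := by exact_mod_cast hu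
  have h1 : (16 : ℝ) * u ≤ n := by exact_mod_cast h
  rw [shrinkLog, max_eq_left]
  rw [le_div_iff₀ (by linarith)]
  linarith

/-- In the shrinking phase the potential falls by one, up to an error that is linear in the new
number of uninformed nodes. -/
theorem shrinkUpper_le {u u' : ℕ} (hu : 1 ≤ u) (hu' : u' ≤ u) (h : 16 * u ≤ n) :
    shrinkUpper n u' ≤ shrinkUpper n u - 1 - 3 / shrinkLog n u +
      n * u' / (2 * u ^ 2) * (1 / (Real.log 2 * shrinkLog n u) + 3 / shrinkLog n u ^ 2) := by
  have hl := two_le_shrinkLog n u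
  have hlog2 : 0 < Real.log 2 := Real.log_pos (by norm_num)
  have hu1 : (1 : ℝ) ≤ u := by exact_mod_cast hu
  have hn0 : (0 : ℝ) < n := by exact_mod_cast (by omega : 0 < n)
  have hL : 0 < Real.log n := log_pos_of_two_le (by omega)
  rcases Nat.eq_zero_or_pos u' with rfl | hu'0
  · rw [shrinkUpper, if_pos rfl, shrinkUpper, if_neg (by omega)]
    have h1 : 0 ≤ Real.logb 2 (Real.log n / shrinkLog n u) := by
      refine Real.logb_nonneg (by norm_num) ?_
      rw [one_le_div (by linarith), shrinkLog_of_le hu h]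
      exact Real.log_le_log (by positivity) (div_le_self hn0.le (by linarith))
    have h2 : 6 / shrinkLog n u = 2 * (3 / shrinkLog n u) := by ring
    have h3 : 0 ≤ 3 / shrinkLog n u := by positivity
    rw [h2]
    simp only [Nat.cast_zero, mul_zero, zero_div, zero_mul, add_zero]
    linarith
  · have hu'1 : (1 : ℝ) ≤ u' := by exact_mod_cast hu'0
    rw [shrinkUpper, shrinkUpper, if_neg (by omega), if_neg (by omega)]
    have hll := shrinkLog_anti (n := n) hu'0 hu'
    -- `W` is the ratio of `2u'/n` to `(2u/n)²`, so `log W` measures the failure of `shrinkLog` to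
    -- double. Bounding `log W` by `W` makes the error linear in `u'`, hence controlled by the mean
    -- alone.
    set W : ℝ := n * u' / (2 * u ^ 2) with hW
    have hW0 : 0 < W := by positivity
    have hlogW : Real.log W = 2 * shrinkLog n u - shrinkLog n u' := by
      rw [shrinkLog_of_le hu h, shrinkLog_of_le hu'0 (by omega)]
      have : W = (n / (2 * u)) ^ 2 / (n / (2 * u')) := by
        rw [hW]
        field_simp
      rw [this, Real.log_div (by positivity) (by positivity), Real.log_pow]
      push_cast
      ring
    have hWl : 2 * shrinkLog n u - shrinkLog n u' ≤ W := by
      rw [← hlogW]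
      linarith [Real.log_le_sub_one_of_pos hW0]
    set l := shrinkLog n u
    set l' := shrinkLog n u'
    have hl0 : 0 < l := by linarith
    have hl'0 : 0 < l' := by linarith
    have h1 : (2 * l - l') / l' ≤ W / l := by
      rcases le_total (2 * l - l') 0 with h0 | h0
      · exact (div_nonpos_of_nonpos_of_nonneg h0 hl'0.le).trans (by positivity)
      · exact div_le_div₀ hW0.le hWl hl0 hll
    have h2 : Real.logb 2 (Real.log n / l') ≤ Real.logb 2 (Real.log n / l) - 1 +
        W / (Real.log 2 * l) := by
      have e1 : Real.log n / l' = Real.log n / l * (2 * l / l') / 2 := by field_simp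
      rw [e1, Real.logb_div (by positivity) (by norm_num),
        Real.logb_mul (by positivity) (by positivity),
        Real.logb_self_eq_one (by norm_num)]
      have e2 : Real.logb 2 (2 * l / l') ≤ W / (Real.log 2 * l) := by
        rw [Real.logb, mul_comm (Real.log 2), ← div_div]
        refine div_le_div_of_nonneg_right ?_ hlog2.le
        refine (Real.log_le_sub_one_of_pos (by positivity)).trans (le_trans (le_of_eq ?_) h1)
        field_simp
      linarith
    have h3 : 6 / l' ≤ 3 / l + 3 * W / l ^ 2 := by
      have e1 : 6 / l' = 3 / l + 3 / l * ((2 * l - l') / l') := by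
        field_simp
        ring
      have e2 : 3 * W / l ^ 2 = 3 / l * (W / l) := by field_simp
      rw [e1, e2]
      have := mul_le_mul_of_nonneg_left h1 (show 0 ≤ 3 / l by positivity)
      linarith
    have e : W * (1 / (Real.log 2 * l) + 3 / l ^ 2) = W / (Real.log 2 * l) + 3 * W / l ^ 2 := by
      ring
    have e' : 6 / l = 3 / l + 3 / l := by ring
    rw [e, e']
    linarith

end UpperPotential

/-! ### Upper bound for the expected spreading time -/

section UpperBound

variable {n : ℕ}

/-- Upper potential, as a function of the number `k` of informed nodes. -/
noncomputable def upperPotential (n k : ℕ) : ℝ :=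
  (Real.log n - Real.log k) / Real.log (2 - 1 / Real.exp 1) + 36 / k + 40 * (n - k) / n +
    shrinkUpper n (n - k)

theorem sub_two_mul_sq_le_log {t : ℝ} (ht : -(1 / 2) ≤ t) : t - 2 * t ^ 2 ≤ Real.log (1 + t) := by
  have h0 : 0 < 1 + t := by linarith
  refine le_trans ?_ (Real.one_sub_inv_le_log_of_pos h0)
  have : 1 - (1 + t)⁻¹ - (t - 2 * t ^ 2) = t ^ 2 * (1 + 2 * t) / (1 + t) := by
    field_simp
    ring
  have h1 : 0 ≤ t ^ 2 * (1 + 2 * t) / (1 + t) :=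
    div_nonneg (mul_nonneg (sq_nonneg t) (by linarith)) h0.le
  linarith

theorem upperPotential_nonneg (hn : 2 ≤ n) {k : ℕ} (hk : 1 ≤ k) (hkn : k ≤ n) :
    0 ≤ upperPotential n k := by
  have hk1 : (1 : ℝ) ≤ k := by exact_mod_cast hk
  have hkn' : (k : ℝ) ≤ n := by exact_mod_cast hkn
  have h1 : Real.log k ≤ Real.log n := Real.log_le_log (by linarith) hkn'
  have h2 := third_le_log_growthBase
  have h3 : 0 ≤ shrinkUpper n (n - k) := by
    rcases Nat.eq_zero_or_pos (n - k) with h | h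
    · rw [h, shrinkUpper, if_pos rfl]
    · linarith [one_le_shrinkUpper hn h]
  have h4 : 0 ≤ (Real.log n - Real.log k) / Real.log (2 - 1 / Real.exp 1) :=
    div_nonneg (by linarith) (by linarith)
  have h5 : 0 ≤ 40 * (n - k : ℝ) / n := div_nonneg (by linarith) (by linarith)
  have h6 : 0 ≤ 36 / (k : ℝ) := by positivity
  rw [upperPotential]
  linarith

/-- With `b = 2 - 1/e` and `a = 1 + m`, use `log (a/b) ≥ 1 - b/a` and `b ≤ a + k/n`, where `a ≥ 1`.
-/
theorem log_growthBase_sub_le (hn : 1 ≤ n) {k : ℕ} (hk : 2 * k ≤ n) :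
    Real.log (2 - 1 / Real.exp 1) - k / n ≤ Real.log (1 + (1 - missProb n k)) := by
  have h1 := missProb_le_add hn hk
  rw [Real.exp_neg, ← one_div] at h1
  have h2 := three_halves_lt_growthBase
  have h3 := missProb_le_one n k
  have h4 : (0 : ℝ) ≤ k / n := by positivity
  set b := 2 - 1 / Real.exp 1 with hb
  set a := 1 + (1 - missProb n k) with ha
  have ha1 : 1 ≤ a := by linarith
  have h5 := Real.one_sub_inv_le_log_of_pos (show 0 < a / b by
    exact div_pos (by linarith) (by linarith))
  rw [Real.log_div (by linarith) (by linarith), inv_div] at h5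
  have h6 : b / a ≤ 1 + k / n := by
    rw [div_le_iff₀ (by linarith)]
    nlinarith
  linarith

theorem shrinkUpper_sub_le (hn : 2 ≤ n) {k j : ℕ} (h : k ≤ j) :
    shrinkUpper n (n - j) ≤ shrinkUpper n (n - k) := shrinkUpper_mono hn (by omega)

/-- A second-order expansion of the logarithm at the mean makes the main term drop by 1 up to two
errors. The variance costs at most `6/k`, paid by the term `36/k`, which drops by at least `18 m /
k` in expectation. The deviation of `m` from `1 - 1/e` costs `3k/n`, paid by `40 (n - k)/n`. Both
payments use `m ≥ 1/3`. -/
theorem upperPotential_drift_growth (hn : 2 ≤ n) (S : Finset (Fin n)) (hS : 1 ≤ S.card)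
    (hk : 2 * S.card ≤ n) :
    ∫ S', upperPotential n S'.card ∂(singlePull n S).toMeasure ≤
      upperPotential n S.card - 1 := by
  have hlog := log_growthBase_sub_le (by omega) hk
  have hll := third_le_log_growthBase
  have hm3 := div_one_add_le_one_sub_missProb (n := n) (k := S.card) (by omega)
    (x := 1 / 2) (by norm_num) (by
      rw [Nat.cast_sub (by omega), le_div_iff₀ (by exact_mod_cast (by omega : 0 < n))]
      have : 2 * (S.card : ℝ) ≤ n := by exact_mod_cast hk
      linarith)
  norm_num at hm3
  have hq1 := missProb_le_one n S.card
  have hq0 := missProb_nonneg n S.card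
  set k := S.card with hkd
  set l := Real.log (2 - 1 / Real.exp 1) with hl
  obtain ⟨m, hq⟩ : ∃ m, missProb n k = 1 - m := ⟨1 - missProb n k, by ring⟩
  have hμ : meanCard n k = k * (1 + m) := by rw [meanCard, hq]; ring
  rw [hq, sub_sub_cancel] at hlog hm3
  rw [hq] at hq1 hq0
  have hk1 : (1 : ℝ) ≤ k := by exact_mod_cast hS
  have hn0 : (0 : ℝ) < n := by exact_mod_cast (by omega : 0 < n)
  set μ := meanCard n k
  have hμ0 : 0 < μ := by rw [hμ]; positivity
  refine (integral_card_le_of_quadratic S hn (upperPotential n)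
    (α := (Real.log n - Real.log μ) / l + 36 / k - 18 * m / k + 40 * (n - μ) / n +
      shrinkUpper n (n - k)) (β := -1 / (μ * l) - 18 / k ^ 2 - 40 / n) (γ := 2 / (μ ^ 2 * l))
    (by positivity) ?_).trans ?_
  · intro j hj1 hj2 _
    have hkj : (k : ℝ) ≤ j := by exact_mod_cast hj1
    have hj2' : (j : ℝ) ≤ 2 * k := by exact_mod_cast hj2
    have hj0 : (0 : ℝ) < j := by linarith
    -- The chord over `[k, 2k]` of a convex function.
    have h4 : 36 / (j : ℝ) ≤ 36 / k - 18 * (j - k) / k ^ 2 := by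
      have e : 36 / (k : ℝ) - 18 * (j - k) / k ^ 2 - 36 / j =
          18 * (j - k) * (2 * k - j) / (k ^ 2 * j) := by
        field_simp
        ring
      have : 0 ≤ 18 * (j - k : ℝ) * (2 * k - j) / (k ^ 2 * j) :=
        div_nonneg (mul_nonneg (by linarith) (by linarith)) (by positivity)
      linarith
    obtain ⟨t, ht⟩ : ∃ t, t = (j - μ) / μ := ⟨_, rfl⟩
    have hjt : (j : ℝ) = μ * (1 + t) := by
      rw [ht]
      field_simp
      ring
    -- Since `j ≥ k` and the mean is at most `2k`.
    have ht2 : -(1 / 2) ≤ t := by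
      rw [ht, le_div_iff₀ hμ0, hμ]
      nlinarith
    have h1 := sub_two_mul_sq_le_log ht2
    have h2 : Real.log j = Real.log μ + Real.log (1 + t) := by
      rw [hjt, Real.log_mul hμ0.ne']
      intro h0
      rw [h0, mul_zero] at hjt
      linarith
    have h3 : (Real.log n - Real.log j) / l ≤
        (Real.log n - Real.log μ) / l + (-t + 2 * t ^ 2) / l := by
      rw [← add_div]
      exact div_le_div_of_nonneg_right (by linarith) (by linarith)
    have h5 := shrinkUpper_sub_le hn hj1
    have e1 : (-t + 2 * t ^ 2) / l = -1 / (μ * l) * (j - μ) + 2 / (μ ^ 2 * l) * (j - μ) ^ 2 := by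
      rw [ht]
      field_simp
    have e2 : 36 / (k : ℝ) - 18 * (j - k) / k ^ 2 =
        36 / k - 18 * m / k - 18 / k ^ 2 * (j - μ) := by
      rw [hμ]
      field_simp
      ring
    have e3 : 40 * (n - j : ℝ) / n = 40 * (n - μ) / n - 40 / n * (j - μ) := by ring
    rw [upperPotential, e3]
    rw [e1] at h3
    rw [e2] at h4
    linarith
  · rw [upperPotential, hq, sub_sub_cancel]
    have h1 : 2 / (μ ^ 2 * l) * (k * m * (1 - m)) ≤ 6 / k := by
      have hμk : (k : ℝ) ≤ μ := by rw [hμ]; nlinarith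
      have h2 : (k : ℝ) ^ 2 * (1 / 3) ≤ μ ^ 2 * l :=
        mul_le_mul (by gcongr) hll (by norm_num) (by positivity)
      have h3 : 2 / (μ ^ 2 * l) ≤ 2 / ((k : ℝ) ^ 2 * (1 / 3)) :=
        div_le_div_of_nonneg_left (by norm_num) (by positivity) h2
      have h4 : (k : ℝ) * m * (1 - m) ≤ k := by
        have : m * (1 - m) ≤ 1 := by nlinarith
        nlinarith
      calc 2 / (μ ^ 2 * l) * (k * m * (1 - m)) ≤ 2 / ((k : ℝ) ^ 2 * (1 / 3)) * k :=
            mul_le_mul h3 h4 (mul_nonneg (mul_nonneg (by linarith) (by linarith)) hq0)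
              (by positivity)
        _ = 6 / k := by field_simp; norm_num
    have h2 : 6 / (k : ℝ) ≤ 18 * m / k := div_le_div_of_nonneg_right (by linarith) (by linarith)
    have h3 : Real.log μ = Real.log k + Real.log (1 + m) := by
      rw [hμ, Real.log_mul (by linarith) (by linarith)]
    have h4 : (Real.log n - Real.log μ) / l ≤ (Real.log n - Real.log k) / l - 1 + 3 * (k / n) := by
      have e : (Real.log n - Real.log k) / l - 1 + (k / n) / l =
          (Real.log n - Real.log k - l + k / n) / l := by
        field_simp
      have h5 : (k / n : ℝ) / l ≤ 3 * (k / n) := by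
        rw [div_le_iff₀ (by linarith)]
        have : (0 : ℝ) ≤ k / n := by positivity
        nlinarith
      have h6 : (Real.log n - Real.log μ) / l ≤ (Real.log n - Real.log k - l + k / n) / l :=
        div_le_div_of_nonneg_right (by linarith) (by linarith)
      linarith
    have h5 : 40 * (n - μ) / n ≤ 40 * (n - k) / n - 3 * (k / n) := by
      have e : 40 * (n - k : ℝ) / n - 3 * (k / n) - 40 * (n - μ) / n =
          (40 * m - 3) * (k / n) := by
        rw [hμ]
        field_simp
        ring
      have : 0 ≤ (40 * m - 3) * (k / n : ℝ) := mul_nonneg (by linarith) (by positivity)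
      linarith
    linarith

theorem upperPotential_le_of_le {k j : ℕ} (hk : 1 ≤ k) (hkj : k ≤ j) :
    upperPotential n j ≤ upperPotential n k - 40 / n * (j - k) - shrinkUpper n (n - k) +
      shrinkUpper n (n - j) := by
  have hk1 : (1 : ℝ) ≤ k := by exact_mod_cast hk
  have hkj' : (k : ℝ) ≤ j := by exact_mod_cast hkj
  have hll := third_le_log_growthBase
  have h1 : Real.log k ≤ Real.log j := Real.log_le_log (by linarith) hkj'
  have h2 : (Real.log n - Real.log j) / Real.log (2 - 1 / Real.exp 1) ≤
      (Real.log n - Real.log k) / Real.log (2 - 1 / Real.exp 1) :=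
    div_le_div_of_nonneg_right (by linarith) (by linarith)
  have h3 : 36 / (j : ℝ) ≤ 36 / k := div_le_div_of_nonneg_left (by norm_num) (by linarith) hkj'
  have e : 40 * (n - j : ℝ) / n = 40 * (n - k) / n - 40 / n * (j - k) := by ring
  rw [upperPotential, upperPotential, e]
  linarith

/-- The linear term alone suffices: more than `n/2` informed nodes and `m ≥ 1/17` give an expected
drop of at least `40/34`. The other terms do not increase. -/
theorem upperPotential_drift_middle (hn : 2 ≤ n) (S : Finset (Fin n)) (hS : 1 ≤ S.card)
    (hk : n < 2 * S.card) (hu : n < 16 * (n - S.card)) :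
    ∫ S', upperPotential n S'.card ∂(singlePull n S).toMeasure ≤
      upperPotential n S.card - 1 := by
  have hn0 : (0 : ℝ) < n := by exact_mod_cast (by omega : 0 < n)
  have hm := div_one_add_le_one_sub_missProb (n := n) (k := S.card) (by omega)
    (x := 1 / 16) (by norm_num) (by
      rw [le_div_iff₀ hn0]
      have : (n : ℝ) ≤ 16 * (n - S.card : ℕ) := by exact_mod_cast hu.le
      linarith)
  norm_num at hm
  set k := S.card with hkd
  refine (integral_card_le_of_quadratic S hn (upperPotential n)
    (α := upperPotential n k - 40 / n * (k * (1 - missProb n k))) (β := -40 / n) (γ := 0)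
    le_rfl ?_).trans ?_
  · intro j hj _ _
    have h1 := upperPotential_le_of_le (n := n) hS hj
    have h2 := shrinkUpper_sub_le hn hj
    rw [meanCard]
    refine (h1.trans (by linarith : _ ≤ upperPotential n k - 40 / n * (j - k))).trans_eq ?_
    ring
  · have hk2 : (n : ℝ) ≤ 2 * k := by exact_mod_cast hk.le
    have : 1 ≤ 40 / n * (k * (1 - missProb n k)) := by
      rw [div_mul_eq_mul_div, le_div_iff₀ hn0]
      nlinarith
    linarith

/-- The expected new number of uninformed nodes is at most `(3/2) u²/n`, so the ratio `n u' / (2u²)`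
has mean at most `3/4`. Its coefficient `c` is at most `3/l`, exactly what the correction `6/l`
releases when `l` doubles. -/
theorem upperPotential_drift_shrinking (hn : 2 ≤ n) (S : Finset (Fin n)) (hS : 1 ≤ S.card)
    (hk : S.card < n) (hu : 16 * (n - S.card) ≤ n) :
    ∫ S', upperPotential n S'.card ∂(singlePull n S).toMeasure ≤
      upperPotential n S.card - 1 := by
  have hn0 : (0 : ℝ) < n := by exact_mod_cast (by omega : 0 < n)
  have hm := le_one_sub_missProb (n := n) (k := S.card) (by omega)
  set k := S.card with hkd
  have hu1 : 1 ≤ n - k := by omega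
  have hl := two_le_shrinkLog n (n - k)
  set l := shrinkLog n (n - k)
  obtain ⟨u, hud⟩ : ∃ u : ℝ, u = ((n - k : ℕ) : ℝ) := ⟨_, rfl⟩
  have huk : u = n - k := by rw [hud, Nat.cast_sub hk.le]
  have hu0 : 1 ≤ u := by rw [hud]; exact_mod_cast hu1
  rw [← hud] at hm
  set c := 1 / (Real.log 2 * l) + 3 / l ^ 2 with hc
  have hlog2 := Real.log_two_gt_d9
  have hc0 : 0 ≤ c := by positivity
  refine (integral_card_le_of_quadratic S hn (upperPotential n)
    (α := upperPotential n k - 1 - 3 / l + n * (n - meanCard n k) / (2 * u ^ 2) * c)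
    (β := -(n / (2 * u ^ 2) * c)) (γ := 0) le_rfl ?_).trans ?_
  · intro j hj _ hjn
    have h1 := upperPotential_le_of_le (n := n) hS hj
    have h2 := shrinkUpper_le (n := n) hu1 (show n - j ≤ n - k by omega) hu
    rw [← hud, Nat.cast_sub hjn] at h2
    have h3 : 0 ≤ 40 / (n : ℝ) * (j - k) :=
      mul_nonneg (by positivity) (sub_nonneg.2 (by exact_mod_cast hj))
    refine (show upperPotential n j ≤ upperPotential n k - 1 - 3 / l +
      n * (n - j) / (2 * u ^ 2) * c by linarith).trans_eq ?_
    ring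
  · have h1 : n * (n - meanCard n k) / (2 * u ^ 2) ≤ 1 := by
      rw [div_le_one (by positivity), meanCard]
      have hk0 : (0 : ℝ) ≤ k := by positivity
      have hkn : (k : ℝ) = n - u := by linarith
      have hun : u ≤ n := by linarith
      have h2 := mul_le_mul_of_nonneg_left hm hk0
      have h3 : (k : ℝ) * (u / n - (u / n) ^ 2 / 2) =
          u - 3 / 2 * (u ^ 2 / n) + u ^ 3 / (2 * n ^ 2) := by
        rw [hkn]
        field_simp
        ring
      have h4 : 0 ≤ u ^ 3 / (2 * (n : ℝ) ^ 2) := by positivity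
      have h5 : (n : ℝ) - (k + k * (1 - missProb n k)) ≤ 3 / 2 * (u ^ 2 / n) := by linarith
      have h6 := mul_le_mul_of_nonneg_left h5 hn0.le
      have h7 : (n : ℝ) * (3 / 2 * (u ^ 2 / n)) = 3 / 2 * u ^ 2 := by field_simp
      nlinarith [sq_nonneg u]
    have h2 := mul_le_mul_of_nonneg_right h1 hc0
    -- This uses `l ≥ 2`, the reason for truncating `shrinkLog` at `log 8`.
    have h3 : c ≤ 3 / l := by
      have e1 : c = (1 / Real.log 2 + 3 / l) / l := by
        rw [hc]
        field_simp
      have e2 : 1 / Real.log 2 ≤ 3 / 2 := by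
        rw [div_le_iff₀ (by linarith)]
        linarith
      have e3 : 3 / l ≤ 3 / 2 := div_le_div_of_nonneg_left (by norm_num) (by norm_num) hl
      rw [e1]
      exact div_le_div_of_nonneg_right (by linarith) (by linarith)
    linarith

/-- The constant is `36 + 40 + 3 + 3`, the last summand bounding `6/l`. -/
theorem upperPotential_one_le (hn : 2 ≤ n) :
    upperPotential n 1 ≤ Real.logb (2 - 1 / Real.exp 1) n + Real.logb 2 (Real.log n) + 82 := by
  have hn0 : (0 : ℝ) < n := by exact_mod_cast (by omega : 0 < n)
  have hl := two_le_shrinkLog n (n - 1)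
  have hL := log_pos_of_two_le hn
  rw [upperPotential, shrinkUpper, if_neg (by omega), Real.logb_div hL.ne' (by linarith)]
  have h1 : 0 ≤ Real.logb 2 (shrinkLog n (n - 1)) :=
    Real.logb_nonneg (by norm_num) (by linarith)
  have h2 : 6 / shrinkLog n (n - 1) ≤ 3 := by
    rw [div_le_iff₀ (by linarith)]
    linarith
  have h3 : 40 * (n - (1 : ℕ) : ℝ) / n ≤ 40 := by
    rw [div_le_iff₀ hn0]
    push_cast
    linarith
  have h4 : (Real.log n - Real.log (1 : ℕ)) / Real.log (2 - 1 / Real.exp 1) =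
      Real.logb (2 - 1 / Real.exp 1) n := by
    rw [Nat.cast_one, Real.log_one, sub_zero, Real.logb]
  rw [h4]
  push_cast at h3 ⊢
  linarith

theorem expectedSpreadingTime_upper_bound (hn : 2 ≤ n) (v : Fin n) :
    expectedSpreadingTime (singlePull n) v ≤ ENNReal.ofReal
      (Real.logb (2 - 1 / Real.exp 1) n + Real.logb 2 (Real.log n) + 82) := by
  refine (expectedSpreadingTime_singlePull_le v (upperPotential n)
    (fun k h1 h2 => upperPotential_nonneg hn h1 h2) fun S hS hSn => ?_).trans
    (ENNReal.ofReal_le_ofReal (upperPotential_one_le hn))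
  rcases le_or_gt (2 * S.card) n with h | h
  · exact upperPotential_drift_growth hn S hS h
  rcases le_or_gt (16 * (n - S.card)) n with h' | h'
  · exact upperPotential_drift_shrinking hn S hS hSn h'
  · exact upperPotential_drift_middle hn S hS h h'

end UpperBound

/-! ### Lower bound for the expected spreading time -/

section LowerBound

variable {n : ℕ}

/-- `log (2 n / u)`, truncated from below at `log 4`. -/
noncomputable def shrinkLogLower (n u : ℕ) : ℝ := Real.log (2 * n / min (u : ℝ) (n / 2))

theorem log_four_le_shrinkLogLower {u : ℕ} (hu : 1 ≤ u) (hn : 1 ≤ n) :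
    Real.log 4 ≤ shrinkLogLower n u := by
  have hn0 : (0 : ℝ) < n := by exact_mod_cast hn
  have hu0 : (0 : ℝ) < u := by exact_mod_cast hu
  refine Real.log_le_log (by norm_num) ?_
  have h0 : 0 < min (u : ℝ) (n / 2) := lt_min hu0 (by positivity)
  rw [le_div_iff₀ h0]
  linarith [min_le_right (u : ℝ) (n / 2)]

theorem one_lt_log_four : 1 < Real.log 4 := by
  rw [show (4 : ℝ) = 2 ^ 2 by norm_num, Real.log_pow]
  push_cast
  linarith [Real.log_two_gt_d9]

theorem log_four_le_two : Real.log 4 ≤ 2 := by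
  rw [show (4 : ℝ) = 2 ^ 2 by norm_num, Real.log_pow]
  push_cast
  linarith [Real.log_two_lt_d9]

/-- Lower potential of the shrinking phase, as a function of the number `u` of uninformed
nodes. -/
noncomputable def shrinkLower (n u : ℕ) : ℝ :=
  if u = 0 then 0
  else max 0 (Real.logb 2 (Real.log n / 4) - Real.logb 2 (shrinkLogLower n u))

theorem shrinkLower_nonneg (n u : ℕ) : 0 ≤ shrinkLower n u := by
  unfold shrinkLower
  split_ifs
  · exact le_rfl
  · exact le_max_left _ _

theorem shrinkLower_eq_of_le {u u' : ℕ} (hu : n ≤ 2 * u) (hu' : n ≤ 2 * u') (h0 : 1 ≤ u)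
    (h0' : 1 ≤ u') : shrinkLower n u' = shrinkLower n u := by
  have h : (n : ℝ) ≤ 2 * u := by exact_mod_cast hu
  have h' : (n : ℝ) ≤ 2 * u' := by exact_mod_cast hu'
  rw [shrinkLower, shrinkLower, shrinkLogLower, shrinkLogLower, if_neg (by omega),
    if_neg (by omega), min_eq_right (by linarith), min_eq_right (by linarith)]

theorem shrinkLower_le (hn : 2 ≤ n) (u : ℕ) : shrinkLower n u ≤ Real.log n / 2 := by
  have hL := log_pos_of_two_le hn
  unfold shrinkLower
  split_ifs with h
  · linarith
  · refine max_le (by linarith) ?_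
    have h1 : 0 ≤ Real.logb 2 (shrinkLogLower n u) :=
      Real.logb_nonneg (by norm_num) (one_lt_log_four.le.trans
        (log_four_le_shrinkLogLower (by omega) (by omega)))
    have h2 : Real.logb 2 (Real.log n / 4) ≤ Real.log n / 2 := by
      have h3 := Real.log_two_gt_d9
      rw [Real.logb, div_le_iff₀ (by linarith)]
      have := Real.log_le_sub_one_of_pos (show 0 < Real.log n / 4 by positivity)
      nlinarith
    linarith

/-- The potential falls by at most one if the square of the fraction of uninformed nodes is
not undershot by more than a factor of two. -/
theorem shrinkLower_sub_one_le (hn : 2 ≤ n) {u u' : ℕ} (hu : 1 ≤ u) (hun : u ≤ n)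
    (h : (u : ℝ) ^ 2 / (2 * n) ≤ u') : shrinkLower n u - 1 ≤ shrinkLower n u' := by
  have hn0 : (0 : ℝ) < n := by exact_mod_cast (by omega : 0 < n)
  have hu0 : (0 : ℝ) < u := by exact_mod_cast hu
  have hun' : (u : ℝ) ≤ n := by exact_mod_cast hun
  have hu'0 : (0 : ℝ) < u' := lt_of_lt_of_le (by positivity) h
  have hu'1 : 1 ≤ u' := by exact_mod_cast hu'0
  have h4 := one_lt_log_four
  have hl := log_four_le_shrinkLogLower (n := n) hu (by omega)
  have hl' := log_four_le_shrinkLogLower (n := n) hu'1 (by omega)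
  -- The factor 2 in `log (2n/u)` is chosen for this: `u' ≥ u²/(2n)` says exactly `2n/u' ≤ (2n/u)²`.
  -- The truncation at `n/2` respects the inequality.
  have key : shrinkLogLower n u' ≤ 2 * shrinkLogLower n u := by
    have hw0 : 0 < min (u : ℝ) (n / 2) := lt_min hu0 (by positivity)
    have hw1 := min_le_left (u : ℝ) (n / 2)
    have hw2 := min_le_right (u : ℝ) (n / 2)
    have hw'0 : 0 < min (u' : ℝ) (n / 2) := lt_min hu'0 (by positivity)
    rw [shrinkLogLower, shrinkLogLower]
    set w := min (u : ℝ) (n / 2)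
    have h1 : w ^ 2 / (2 * n) ≤ min (u' : ℝ) (n / 2) := by
      refine le_min (le_trans ?_ h) ?_
      · exact div_le_div_of_nonneg_right (by nlinarith) (by positivity)
      · rw [div_le_iff₀ (by positivity)]
        nlinarith
    have h2 : 2 * Real.log (2 * n / w) = Real.log ((2 * n / w) ^ 2) := by
      rw [Real.log_pow]
      push_cast
      rfl
    rw [h2]
    refine Real.log_le_log (by positivity) ?_
    rw [div_le_iff₀ hw'0]
    refine le_trans (le_of_eq ?_) (mul_le_mul_of_nonneg_left h1 (by positivity))
    field_simp
  have h5 : Real.logb 2 (shrinkLogLower n u') ≤ 1 + Real.logb 2 (shrinkLogLower n u) := by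
    rw [← Real.logb_self_eq_one (b := 2) (by norm_num), ← Real.logb_mul (by norm_num)
      (by linarith)]
    exact Real.logb_le_logb_of_le (by norm_num) (by linarith) key
  rw [shrinkLower, shrinkLower, if_neg (by omega), if_neg (by omega), sub_le_iff_le_add]
  refine max_le ?_ ?_
  · linarith [le_max_left 0 (Real.logb 2 (Real.log n / 4) - Real.logb 2 (shrinkLogLower n u'))]
  · linarith [le_max_right 0 (Real.logb 2 (Real.log n / 4) - Real.logb 2 (shrinkLogLower n u'))]

/-- The error of the drift of the lower potential. -/
noncomputable def driftError (n : ℕ) : ℝ := 2 * Real.log n * Real.exp (-(Real.log n / 4))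

theorem shrinkLower_mul_le (hn : 2 ≤ n) {u : ℕ} (hu : 1 ≤ u) :
    shrinkLower n u * (4 * n ^ 2 / u ^ 3) ≤ driftError n := by
  have hL := log_pos_of_two_le hn
  have hn0 : (0 : ℝ) < n := by exact_mod_cast (by omega : 0 < n)
  have hu0 : (0 : ℝ) < u := by exact_mod_cast hu
  have hη : 0 ≤ driftError n := by
    unfold driftError
    positivity
  rcases (shrinkLower_nonneg n u).eq_or_lt' with h | h
  · rw [h, zero_mul]
    exact hη
  -- A positive potential forces `n/u ≤ n^(1/4)`, and then `n²/u³ ≤ n^(-1/4)`.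
  have h1 : shrinkLogLower n u < Real.log n / 4 := by
    rw [shrinkLower, if_neg (by omega), lt_max_iff] at h
    have h2 := (h.resolve_left (lt_irrefl 0))
    rw [sub_pos] at h2
    have h3 := log_four_le_shrinkLogLower (n := n) hu (by omega)
    exact (Real.logb_lt_logb_iff (by norm_num) (by linarith [one_lt_log_four])
      (by positivity)).1 h2
  have h2 : (n / u : ℝ) ≤ Real.exp (Real.log n / 4) := by
    have hw0 : 0 < min (u : ℝ) (n / 2) := lt_min hu0 (by positivity)
    rw [shrinkLogLower, Real.log_lt_iff_lt_exp (by positivity)] at h1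
    refine le_trans ?_ h1.le
    rw [div_le_div_iff₀ hu0 hw0]
    nlinarith [min_le_left (u : ℝ) (n / 2)]
  have h3 : 4 * (n : ℝ) ^ 2 / u ^ 3 ≤ 4 * Real.exp (-(Real.log n / 4)) := by
    have e1 : 4 * (n : ℝ) ^ 2 / u ^ 3 = 4 * ((n / u : ℝ) ^ 3 * (n : ℝ)⁻¹) := by
      field_simp
    have e2 : (n : ℝ)⁻¹ = Real.exp (-Real.log n) := by
      rw [Real.exp_neg, Real.exp_log hn0]
    rw [e1, e2]
    have e3 : Real.exp (-(Real.log n / 4)) =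
        Real.exp (Real.log n / 4) ^ 3 * Real.exp (-Real.log n) := by
      rw [← Real.exp_nat_mul, ← Real.exp_add]
      congr 1
      push_cast
      ring
    rw [e3]
    gcongr
  calc shrinkLower n u * (4 * n ^ 2 / u ^ 3) ≤
        Real.log n / 2 * (4 * Real.exp (-(Real.log n / 4))) :=
        mul_le_mul (shrinkLower_le hn u) h3 (by positivity) (by positivity)
    _ = driftError n := by
        rw [driftError]
        ring

/-- Lower potential, as a function of the number `k` of informed nodes. -/
noncomputable def lowerPotential (n k : ℕ) : ℝ :=
  max 0 ((Real.log n - Real.log 4 - Real.log k) / Real.log (2 - 1 / Real.exp 1)) +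
    shrinkLower n (n - k)

theorem lowerPotential_nonneg (n k : ℕ) : 0 ≤ lowerPotential n k :=
  add_nonneg (le_max_left _ _) (shrinkLower_nonneg _ _)

theorem max_eq_zero_of_le (hn : 2 ≤ n) {k : ℕ} (h : n ≤ 4 * k) :
    max 0 ((Real.log n - Real.log 4 - Real.log k) / Real.log (2 - 1 / Real.exp 1)) = 0 := by
  have hk : (0 : ℝ) < k := by exact_mod_cast (by omega : 0 < k)
  have h1 : Real.log n ≤ Real.log 4 + Real.log k := by
    rw [← Real.log_mul (by norm_num) hk.ne']
    exact Real.log_le_log (by exact_mod_cast (by omega : 0 < n)) (by exact_mod_cast h)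
  exact max_eq_left (div_nonpos_of_nonpos_of_nonneg (by linarith)
    (by linarith [third_le_log_growthBase]))

/-- The logarithm lies below its tangent at the mean, and the mean is at most `(2 - 1/e) k`, so no
variance bound is needed. -/
theorem lowerPotential_drift_growth (hn : 2 ≤ n) (S : Finset (Fin n)) (hS : 1 ≤ S.card)
    (hk : 4 * S.card < n) : lowerPotential n S.card - 1 ≤
      ∫ S', lowerPotential n S'.card ∂(singlePull n S).toMeasure := by
  have hq := exp_neg_one_le_missProb hn hS
  rw [Real.exp_neg, ← one_div] at hq
  have hq1 := missProb_le_one n S.card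
  have hll := third_le_log_growthBase
  set k := S.card with hkd
  have hk1 : (1 : ℝ) ≤ k := by exact_mod_cast hS
  have hn0 : (0 : ℝ) < n := by exact_mod_cast (by omega : 0 < n)
  have hμ : meanCard n k = k * (1 + (1 - missProb n k)) := by rw [meanCard]; ring
  have hμ0 : 0 < meanCard n k := by
    rw [hμ]
    exact mul_pos (by linarith) (by linarith)
  have hμ' : Real.log (meanCard n k) ≤ Real.log k + Real.log (2 - 1 / Real.exp 1) := by
    rw [hμ, Real.log_mul (by linarith) (by linarith)]
    have := Real.log_le_log (show 0 < 1 + (1 - missProb n k) by linarith)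
      (show 1 + (1 - missProb n k) ≤ 2 - 1 / Real.exp 1 by linarith)
    linarith
  set l := Real.log (2 - 1 / Real.exp 1) with hl
  set μ := meanCard n k
  refine le_trans ?_ (le_integral_card_of_quadratic S hn (lowerPotential n)
    (α := (Real.log n - Real.log 4 - Real.log μ) / l + shrinkLower n (n - k))
    (β := -1 / (μ * l)) (γ := 0) le_rfl ?_)
  · have h1 : (Real.log n - Real.log 4 - Real.log k) / l - 1 ≤
        (Real.log n - Real.log 4 - Real.log μ) / l := by
      have e : (Real.log n - Real.log 4 - Real.log k) / l - 1 =
          (Real.log n - Real.log 4 - Real.log k - l) / l := by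
        field_simp
      rw [e]
      exact div_le_div_of_nonneg_right (by linarith) (by linarith)
    have h2 : 0 ≤ (Real.log n - Real.log 4 - Real.log k) / l := by
      refine div_nonneg ?_ (by linarith)
      have : Real.log 4 + Real.log k ≤ Real.log n := by
        rw [← Real.log_mul (by norm_num) (by linarith)]
        exact Real.log_le_log (by linarith) (by exact_mod_cast hk.le)
      linarith
    rw [lowerPotential, max_eq_right h2]
    linarith
  · intro j hj1 hj2 _
    have hkj : (k : ℝ) ≤ j := by exact_mod_cast hj1
    have hj0 : (0 : ℝ) < j := by linarith
    have h1 : Real.log j ≤ Real.log μ + (j - μ) / μ := by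
      have h2 := Real.log_le_sub_one_of_pos (show 0 < j / μ by positivity)
      rw [Real.log_div hj0.ne' hμ0.ne'] at h2
      have : (j - μ) / μ = j / μ - 1 := by field_simp
      linarith
    have h3 : (Real.log n - Real.log 4 - Real.log μ - (j - μ) / μ) / l ≤
        (Real.log n - Real.log 4 - Real.log j) / l :=
      div_le_div_of_nonneg_right (by linarith) (by linarith)
    have e : (Real.log n - Real.log 4 - Real.log μ - (j - μ) / μ) / l =
        (Real.log n - Real.log 4 - Real.log μ) / l + -1 / (μ * l) * (j - μ) := by
      field_simp
      ring
    -- As `j ≤ 2k < n/2`, more than half of the nodes stay uninformed, where the truncation at `n/2`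
    -- makes this term constant.
    have h4 : shrinkLower n (n - j) = shrinkLower n (n - k) :=
      shrinkLower_eq_of_le (by omega) (by omega) (by omega) (by omega)
    rw [lowerPotential, h4]
    have h5 := le_max_right 0 ((Real.log n - Real.log 4 - Real.log j) / l)
    linarith

/-- Chebyshev's inequality: `u'` has mean at least `u²/n` and variance at most `u`, so it falls
below `u²/(2n)` with probability at most `4n²/u³`. Otherwise the potential drops by at most 1; in
the bad event at most all of `M` is lost. -/
theorem lowerPotential_drift_shrinking (hn : 2 ≤ n) (S : Finset (Fin n)) (hS : 1 ≤ S.card)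
    (hk : n ≤ 4 * S.card) (hkn : S.card < n) : lowerPotential n S.card ≤ 1 + driftError n +
      ∫ S', lowerPotential n S'.card ∂(singlePull n S).toMeasure := by
  have hm := one_sub_missProb_le (n := n) (k := S.card) (by omega)
  have hq1 := missProb_le_one n S.card
  have hq0 := missProb_nonneg n S.card
  have hn0 : (0 : ℝ) < n := by exact_mod_cast (by omega : 0 < n)
  set k := S.card with hkd
  have hu1 : 1 ≤ n - k := by omega
  have hη := shrinkLower_mul_le hn hu1
  have hM := shrinkLower_nonneg n (n - k)
  have hkn' : (k : ℝ) ≤ n := by exact_mod_cast hkn.le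
  set M := shrinkLower n (n - k) with hMd
  have hu0' : (1 : ℝ) ≤ (n - k : ℕ) := by exact_mod_cast hu1
  have huk' : ((n - k : ℕ) : ℝ) = n - k := Nat.cast_sub hkn.le
  obtain ⟨u, hud⟩ : ∃ u : ℝ, u = ((n - k : ℕ) : ℝ) := ⟨_, rfl⟩
  rw [← hud] at hm hη hu0' huk'
  have hlow : lowerPotential n k = M := by
    rw [lowerPotential, max_eq_zero_of_le hn hk, zero_add]
  have hint := le_integral_card_of_quadratic S hn (lowerPotential n)
    -- The quadratic term is at least `M` whenever `u' < u²/(2n)`.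
    (α := M - 1) (β := 0) (γ := M * (4 * n ^ 2 / u ^ 4)) (by positivity) ?_
  · have h1 : (k : ℝ) * (1 - missProb n k) * missProb n k ≤ u := by
      have h2 : (k : ℝ) * (1 - missProb n k) ≤ n * (u / n) :=
        mul_le_mul hkn' hm (by linarith) hn0.le
      have h3 : (n : ℝ) * (u / n) = u := by field_simp
      rw [h3] at h2
      have h4 : 0 ≤ (k : ℝ) * (1 - missProb n k) := mul_nonneg (by positivity) (by linarith)
      nlinarith
    have h2 : M * (4 * n ^ 2 / u ^ 4) * (k * (1 - missProb n k) * missProb n k) ≤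
        M * (4 * n ^ 2 / u ^ 4) * u := mul_le_mul_of_nonneg_left h1 (by positivity)
    have h3 : M * (4 * n ^ 2 / u ^ 4) * u = M * (4 * n ^ 2 / u ^ 3) := by
      field_simp
    rw [hlow]
    rw [← hkd] at hint
    linarith
  · intro j hj _ hjn
    have hpos : M - 1 - M * (4 * n ^ 2 / u ^ 4) * (j - meanCard n k) ^ 2 ≤
        shrinkLower n (n - j) := by
      rcases le_or_gt (u ^ 2 / (2 * n)) ((n - j : ℕ) : ℝ) with h | h
      · rw [hud] at h
        have h1 := shrinkLower_sub_one_le hn hu1 (Nat.sub_le _ _) h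
        have h2 : 0 ≤ M * (4 * n ^ 2 / u ^ 4) * (j - meanCard n k) ^ 2 := by positivity
        linarith
      · rw [Nat.cast_sub hjn] at h
        have h1 : u ^ 2 / n ≤ n - meanCard n k := by
          have h2 : (k : ℝ) * (1 - missProb n k) ≤ k * (u / n) :=
            mul_le_mul_of_nonneg_left hm (by positivity)
          have h3 : u ^ 2 / n = u - k * (u / n) := by
            rw [show (k : ℝ) = n - u by linarith]
            field_simp
            ring
          rw [meanCard]
          linarith
        have h2 : u ^ 2 / (2 * n) ≤ j - meanCard n k := by
          have : u ^ 2 / (n : ℝ) = u ^ 2 / (2 * n) + u ^ 2 / (2 * n) := by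
            field_simp
            norm_num
          linarith
        have h3 : (u ^ 2 / (2 * n)) ^ 2 ≤ (j - meanCard n k) ^ 2 :=
          pow_le_pow_left₀ (by positivity) h2 2
        have h4 : 1 ≤ 4 * n ^ 2 / u ^ 4 * (j - meanCard n k) ^ 2 := by
          refine le_trans (le_of_eq ?_) (mul_le_mul_of_nonneg_left h3 (by positivity))
          field_simp
          norm_num
        have h5 := mul_le_mul_of_nonneg_left h4 hM
        have h6 := shrinkLower_nonneg n (n - j)
        linarith
    have h7 := le_max_left 0
      ((Real.log n - Real.log 4 - Real.log j) / Real.log (2 - 1 / Real.exp 1))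
    rw [lowerPotential, ← hkd]
    linarith

theorem driftError_nonneg (n : ℕ) : 0 ≤ driftError n := by
  have := Real.log_natCast_nonneg n
  unfold driftError
  positivity

theorem lowerPotential_drift (hn : 2 ≤ n) (S : Finset (Fin n)) (hkn : S.card < n) :
    lowerPotential n S.card ≤ 1 + driftError n +
      ∫ S', lowerPotential n S'.card ∂(singlePull n S).toMeasure := by
  have hη := driftError_nonneg n
  rcases Nat.eq_zero_or_pos S.card with h | h
  · have := le_integral_card_of_quadratic S hn (lowerPotential n)
      (α := lowerPotential n S.card) (β := 0) (γ := 0) le_rfl fun j h1 h2 _ => by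
        rw [show j = S.card by omega]
        simp
    linarith
  rcases lt_or_ge (4 * S.card) n with h' | h'
  · linarith [lowerPotential_drift_growth hn S h h']
  · exact lowerPotential_drift_shrinking hn S h h' hkn

theorem lowerPotential_self (hn : 2 ≤ n) : lowerPotential n n = 0 := by
  rw [lowerPotential, max_eq_zero_of_le hn (by omega), Nat.sub_self, shrinkLower, if_pos rfl,
    add_zero]

theorem lowerPotential_one_le (hn : 2 ≤ n) : lowerPotential n 1 ≤ 4 * Real.log n := by
  have hL := log_pos_of_two_le hn
  have h1 := shrinkLower_le hn (n - 1)
  have h2 := third_le_log_growthBase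
  have h3 : max 0 ((Real.log n - Real.log 4 - Real.log (1 : ℕ)) /
      Real.log (2 - 1 / Real.exp 1)) ≤ 3 * Real.log n := by
    refine max_le (by linarith) ?_
    rw [Nat.cast_one, Real.log_one, div_le_iff₀ (by linarith)]
    nlinarith [one_lt_log_four]
  rw [lowerPotential]
  linarith

theorem le_lowerPotential_one (hn : 2 ≤ n) :
    Real.logb (2 - 1 / Real.exp 1) n + Real.logb 2 (Real.log n) - 9 ≤ lowerPotential n 1 := by
  have hL := log_pos_of_two_le hn
  have hll := third_le_log_growthBase
  have hn0 : (2 : ℝ) ≤ n := by exact_mod_cast hn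
  have h1 := le_max_right 0 ((Real.log n - Real.log 4 - Real.log (1 : ℕ)) /
      Real.log (2 - 1 / Real.exp 1))
  have h2 : Real.logb (2 - 1 / Real.exp 1) n - 6 ≤
      (Real.log n - Real.log 4 - Real.log (1 : ℕ)) / Real.log (2 - 1 / Real.exp 1) := by
    rw [Nat.cast_one, Real.log_one, sub_zero, sub_div, Real.logb]
    have : Real.log 4 / Real.log (2 - 1 / Real.exp 1) ≤ 6 := by
      rw [div_le_iff₀ (by linarith)]
      linarith [log_four_le_two]
    linarith
  have h3 : Real.logb 2 (Real.log n) - 3 ≤ shrinkLower n (n - 1) := by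
    have e1 : shrinkLogLower n (n - 1) = Real.log 4 := by
      rw [shrinkLogLower, Nat.cast_sub (by omega), min_eq_right]
      · congr 1
        field_simp
        norm_num
      · push_cast
        linarith
    have e2 : Real.logb 2 (Real.log 4) ≤ 1 := by
      rw [← Real.logb_self_eq_one (b := 2) (by norm_num)]
      exact Real.logb_le_logb_of_le (by norm_num) (by linarith [one_lt_log_four])
        log_four_le_two
    have e3 : Real.logb 2 4 = 2 := by
      rw [show (4 : ℝ) = 2 ^ (2 : ℝ) by norm_num]
      exact Real.logb_rpow (by norm_num) (by norm_num)
    rw [shrinkLower, if_neg (by omega), e1, Real.logb_div hL.ne' (by norm_num), e3]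
    have := le_max_right 0 (Real.logb 2 (Real.log n) - 2 - Real.logb 2 (Real.log 4))
    linarith
  rw [lowerPotential]
  linarith

/-- With `L = log n` the left side is `8 L² e^(-L/4)`, and `e^(L/4) ≥ L²/32`. -/
theorem driftError_mul_le (hn : 2 ≤ n) : driftError n * (4 * Real.log n) ≤ 256 := by
  have hL := log_pos_of_two_le hn
  have h1 := Real.quadratic_le_exp_of_nonneg (show 0 ≤ Real.log n / 4 by positivity)
  rw [driftError, Real.exp_neg, ← div_eq_mul_inv, div_mul_eq_mul_div,
    div_le_iff₀ (Real.exp_pos _)]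
  nlinarith

theorem expectedSpreadingTime_lower_bound (hn : 2 ≤ n) (v : Fin n) :
    Real.logb (2 - 1 / Real.exp 1) n + Real.logb 2 (Real.log n) - 265 ≤
      (expectedSpreadingTime (singlePull n) v).toReal := by
  have hη := driftError_nonneg n
  have hfin : expectedSpreadingTime (singlePull n) v ≠ ∞ :=
    ne_top_of_le_ne_top ENNReal.ofReal_ne_top (expectedSpreadingTime_upper_bound hn v)
  have key := le_expectedSpreadingTime_singlePull v hfin (lowerPotential n)
    (c := 1 + driftError n) (by linarith) (lowerPotential_nonneg n) (lowerPotential_self hn)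
    (lowerPotential_drift hn)
  have h1 := le_lowerPotential_one hn
  have h2 := mul_le_mul_of_nonneg_left (lowerPotential_one_le hn) hη
  have h3 := driftError_mul_le hn
  set T := (expectedSpreadingTime (singlePull n) v).toReal
  -- If `T` is below the initial potential, then `driftError n * T ≤ 256`, so dropping the error
  -- factor loses at most 256; the other 9 comes from `le_lowerPotential_one`.
  rcases le_total (lowerPotential n 1) T with h | h
  · linarith
  · have := mul_le_mul_of_nonneg_left h hη
    linarith

end LowerBound

end RumorSpreading

/-! ### The main theorem -/

theorem mainTheorem11 :
    (∃ p : ℕ → ℕ → ℝ,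
      (∀ n, RumorSpreading.IsHomogeneous (RumorSpreading.singlePull n) (p n)) ∧
      RumorSpreading.UpperExpGrowth RumorSpreading.singlePull p (fun _ => 1 - 1 / Real.exp 1) ∧
      RumorSpreading.LowerExpGrowth RumorSpreading.singlePull p (fun _ => 1 - 1 / Real.exp 1) ∧
      RumorSpreading.UpperDoubleExpShrinking RumorSpreading.singlePull p 2 ∧
      RumorSpreading.LowerDoubleExpShrinking RumorSpreading.singlePull p 2) ∧
    ∃ C : ℝ, ∀ n : ℕ, 2 ≤ n → ∀ v : Fin n,
      RumorSpreading.expectedSpreadingTime (RumorSpreading.singlePull n) v ≠ ∞ ∧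
      |(RumorSpreading.expectedSpreadingTime (RumorSpreading.singlePull n) v).toReal -
        (Real.logb (2 - 1 / Real.exp 1) n + Real.logb 2 (Real.log n))| ≤ C := by
  refine ⟨⟨RumorSpreading.successProb, RumorSpreading.isHomogeneous_singlePull,
    RumorSpreading.upperExpGrowth_singlePull, RumorSpreading.lowerExpGrowth_singlePull,
    RumorSpreading.upperDoubleExpShrinking_singlePull,
    RumorSpreading.lowerDoubleExpShrinking_singlePull⟩, 265, fun n hn v => ?_⟩
  have hup := RumorSpreading.expectedSpreadingTime_upper_bound hn v
  have hlow := RumorSpreading.expectedSpreadingTime_lower_bound hn v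
  have h0 : 0 ≤ Real.logb (2 - 1 / Real.exp 1) n + Real.logb 2 (Real.log n) + 82 :=
    (RumorSpreading.upperPotential_nonneg hn le_rfl (by omega)).trans
      (RumorSpreading.upperPotential_one_le hn)
  have hup' := ENNReal.toReal_le_of_le_ofReal h0 hup
  refine ⟨ne_top_of_le_ne_top ENNReal.ofReal_ne_top hup, ?_⟩
  rw [abs_le]
  constructor <;> linarith
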